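/- A *quasigroup* is a set $Q$ with a binary operation such that for all $a,b\in Q$ there are unique $c,d\in Q$ with $ac=b$ and $da=b$; a *loop* is a quasigroup with a two-sided identity element. A loop is *right Bol* if $((ca)b)a=c((ab)a)$ for all $a,b,c$, *left Bol* if $a(b(ac))=(a(ba))c$ for all $a,b,c$, and a *Bol loop* if it is right Bol or left Bol. Let $Q$ be a finite Bol loop, let $L$ be its Cayley table (the Latin square with $(a,b)$-entry $ab$), and let $X=\{(a,b,ab) : a,b\in Q\}$. For $0\le i\le 4$ let $A_i$ be the complex $0/1$-matrix indexed by $X\times X$ whose $(x,x')$-entry is $1$ exactly when $x$ and $x'$ agree in all three components ($i=0$), in only the first ($i=1$), in only the second ($i=2$), in only the third ($i=3$), or in no component ($i=4$); these are the relation matrices of the four-class association scheme of $L$. For a base point $p\in X$ let $E_i^*$ be the diagonal matrix whose $(x,x)$-entry is the $(p,x)$-entry of $A_i$. The *Terwilliger algebra* of $L$ with respect to $p$ is the complex algebra of matrices generated by $A_0,\dots,A_4,E_0^*,\dots,E_4^*$. **Theorem.** If $Q$ is a finite Bol loop of order at least $5$, then for every base point $p\in X$ the Terwilliger algebra of its Cayley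 table with respect to $p$ is isomorphic, as a complex associative algebra, to $$\mathbb M_5\oplus\mathbb M_6\oplus\mathbb M_1\qquad\text{or to}\qquad \mathbb M_5\oplus\mathbb M_6\oplus\mathbb M_6\oplus\mathbb M_1,$$ where $\mathbb M_\ell$ denotes the algebra of all complex $\ell\times\ell$ matrices. -/

import Mathlib

/-- Quasigroups: each of the equations `a * c = b` and `d * a = b` has a unique solution. -/
structure IsQuasigroup (Q : Type*) [Mul Q] : Prop where
  existsUnique_mul_left : ∀ a b : Q, ∃! c : Q, a * c = b
  existsUnique_mul_right : ∀ a b : Q, ∃! d : Q, d * a = b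

/-- Loops: quasigroups with a two-sided identity element. -/
structure IsLoop (Q : Type*) [Mul Q] : Prop extends IsQuasigroup Q where
  exists_identity : ∃ e : Q, ∀ a : Q, a * e = a ∧ e * a = a

/-- Right Bol loops. -/
structure IsRightBolLoop (Q : Type*) [Mul Q] : Prop extends IsLoop Q where
  right_bol : ∀ a b c : Q, ((c * a) * b) * a = c * ((a * b) * a)

/-- Left Bol loops. -/
structure IsLeftBolLoop (Q : Type*) [Mul Q] : Prop extends IsLoop Q where
  left_bol : ∀ a b c : Q, a * (b * (a * c)) = (a * (b * a)) * c

/-- Bol loops: loops that are right Bol or left Bol. -/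
def IsBolLoop (Q : Type*) [Mul Q] : Prop :=
  IsRightBolLoop Q ∨ IsLeftBolLoop Q

theorem IsBolLoop.isQuasigroup {Q : Type*} [Mul Q] (h : IsBolLoop Q) : IsQuasigroup Q :=
  h.elim (fun h => h.toIsQuasigroup) (fun h => h.toIsQuasigroup)

/-- A Latin square with rows and columns indexed by `I` and symbols in `S`: every symbol occurs
exactly once in each row and exactly once in each column. -/
structure LatinSquare (I S : Type*) where
  entry : I → I → S
  existsUnique_col : ∀ (r : I) (s : S), ∃! c : I, entry r c = s
  existsUnique_row : ∀ (c : I) (s : S), ∃! r : I, entry r c = s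

/-- The Cayley table of a quasigroup: the `(a, b)`-entry is `a * b`. -/
def cayleyTable {Q : Type*} [Mul Q] (h : IsQuasigroup Q) : LatinSquare Q Q where
  entry a b := a * b
  existsUnique_col := h.existsUnique_mul_left
  existsUnique_row := h.existsUnique_mul_right

namespace LatinSquare

/-- The orthogonal array of `L`: the triples (row, column, entry). -/
def Point {I S : Type*} (L : LatinSquare I S) : Type _ :=
  {x : I × I × S // L.entry x.1 x.2.1 = x.2.2}

/-- The row of a point. -/
def Point.row {I S : Type*} {L : LatinSquare I S} (x : L.Point) : I := x.1.1

/-- The column of a point. -/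
def Point.col {I S : Type*} {L : LatinSquare I S} (x : L.Point) : I := x.1.2.1

/-- The entry (symbol) of a point. -/
def Point.sym {I S : Type*} {L : LatinSquare I S} (x : L.Point) : S := x.1.2.2

instance {I S : Type*} [Finite I] [Finite S] (L : LatinSquare I S) : Finite L.Point :=
  inferInstanceAs (Finite {x : I × I × S // L.entry x.1 x.2.1 = x.2.2})

noncomputable instance {I S : Type*} [Finite I] [Finite S] (L : LatinSquare I S) :
    Fintype L.Point :=
  Fintype.ofFinite L.Point

noncomputable instance {I S : Type*} (L : LatinSquare I S) : DecidableEq L.Point :=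
  Classical.decEq L.Point

/-- The five relations of the association scheme of `L`: two points agree in all three
components (`0`), in only the row (`1`), in only the column (`2`), in only the entry (`3`), or in
no component (`4`). -/
def schemeRel {I S : Type*} (L : LatinSquare I S) (i : Fin 5) (x y : L.Point) : Prop :=
  match i with
  | 0 => x.row = y.row ∧ x.col = y.col ∧ x.sym = y.sym
  | 1 => x.row = y.row ∧ x.col ≠ y.col ∧ x.sym ≠ y.sym
  | 2 => x.row ≠ y.row ∧ x.col = y.col ∧ x.sym ≠ y.sym
  | 3 => x.row ≠ y.row ∧ x.col ≠ y.col ∧ x.sym = y.sym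
  | 4 => x.row ≠ y.row ∧ x.col ≠ y.col ∧ x.sym ≠ y.sym

open Classical in
/-- The relation matrices `A₀, …, A₄` of the four-class association scheme of `L`. -/
noncomputable def relationMatrix {I S : Type*} (L : LatinSquare I S) (i : Fin 5) :
    Matrix L.Point L.Point ℂ :=
  Matrix.of fun x y => if L.schemeRel i x y then 1 else 0

/-- The dual idempotents with respect to the base point `p`: the diagonal matrices whose
`(x, x)`-entry is the `(p, x)`-entry of the corresponding relation matrix. -/
noncomputable def dualIdempotent {I S : Type*} (L : LatinSquare I S) (p : L.Point) (i : Fin 5) :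
    Matrix L.Point L.Point ℂ :=
  Matrix.diagonal fun x => L.relationMatrix i p x

/-- The Terwilliger algebra of (the association scheme of) `L` with respect to the base point
`p`: the complex algebra generated by the relation matrices and the dual idempotents. -/
noncomputable def terwilligerAlgebra {I S : Type*} [Finite I] [Finite S] (L : LatinSquare I S)
    (p : L.Point) : Subalgebra ℂ (Matrix L.Point L.Point ℂ) :=
  Algebra.adjoin ℂ (Set.range L.relationMatrix ∪ Set.range (L.dualIdempotent p))

end LatinSquare

/-! Let the base point be (a, b, ab) and n the order. Rows x are relabelled xb, columns y are
relabelled ay, and symbols are relabelled so that the base point has all three coordinates equal to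
e = ab. On each line through the base point the two remaining coordinates are then related by a
permutation. The Bol identity makes it one and the same involution for all three lines
(`IsBolLoop.mul_eq_mul`, `exists_latinCoordinates`). Nothing else about the loop is used.

The algebra is generated by the projections to the five cells, the three relations "same coordinate"
and the all-ones matrix. Functions of one coordinate split into the indicator of e, the indicator of
its complement, and the eigenspaces V_l, l = ±1, of the involution on functions that vanish at e and
sum to zero. Reading f in V_l off a coordinate and restricting to a cell gives, up to scalars, six
functions: one on each line, where the two nontrivial coordinates differ by the factor l, and three
on the generic cell. Their inner products depend on l alone, so the Gram matrix is a 6 × 6 matrix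
tensored with the projection to V_l (`IsEigen.sum_cell`, `blockCol_transpose_mul`). It is invertible
for n ≥ 5, so a nonzero V_l yields a block M_6. The five cell indicators yield M_5.

The generators lie in the span of these blocks and the identity (`cellAlgebra_le`). Conversely, a
walk around the three lines acts on V_l as l, which separates the two eigenspaces and puts each
block inside the algebra (`blockCol_mul_transpose_mem`). The blocks have total rank 5 + 6(n - 2) <
n², and the complement contributes M_1. V_1 is never zero; whether V_{-1} is zero decides between
the two shapes. -/

open Matrix

set_option linter.unusedSectionVars false

/-! ### Matrix algebras attached to columns with a prescribed Gram matrix -/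

section Blocks

variable {X S ι : Type*} [Fintype X] [Fintype S] [Fintype ι]

/-- The linear combination of the products `C a * (C b)ᵀ` with coefficient matrix `M`. -/
noncomputable def blockMap (C : ι → Matrix X S ℂ) : Matrix ι ι ℂ →ₗ[ℂ] Matrix X X ℂ where
  toFun M := ∑ a, ∑ b, M a b • (C a * (C b)ᵀ)
  map_add' M M' := by simp [add_smul, Finset.sum_add_distrib]
  map_smul' r M := by simp [mul_smul, Finset.smul_sum]

theorem blockMap_apply (C : ι → Matrix X S ℂ) (M : Matrix ι ι ℂ) :
    blockMap C M = ∑ a, ∑ b, M a b • (C a * (C b)ᵀ) := rfl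

theorem blockMap_single [DecidableEq ι] (C : ι → Matrix X S ℂ) (a b : ι) :
    blockMap C (Matrix.single a b 1) = C a * (C b)ᵀ := by
  rw [blockMap_apply, Finset.sum_eq_single a, Finset.sum_eq_single b]
  · simp
  · intro b' _ hb; simp [hb.symm]
  · simp
  · intro a' _ ha
    exact Finset.sum_eq_zero fun b' _ => by simp [ha.symm]
  · simp

/-- The inner factor `(C b)ᵀ * C c` collapses to `G b c • P` and `P` is absorbed by the columns,
which leaves `G` between the coefficient matrices. -/
theorem blockMap_mul_blockMap {C : ι → Matrix X S ℂ} {G : Matrix ι ι ℂ} {P : Matrix S S ℂ}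
    (hC : ∀ a b, (C a)ᵀ * C b = G a b • P) (hP : ∀ a, C a * P = C a) (M M' : Matrix ι ι ℂ) :
    blockMap C M * blockMap C M' = blockMap C (M * G * M') := by
  have key : ∀ a b c d, (C a * (C b)ᵀ) * (C c * (C d)ᵀ) = G b c • (C a * (C d)ᵀ) := by
    intro a b c d
    rw [Matrix.mul_assoc, ← Matrix.mul_assoc (C b)ᵀ, hC, Matrix.smul_mul, Matrix.mul_smul,
      ← Matrix.mul_assoc, hP]
  have lhs : blockMap C M * blockMap C M' =
      ∑ a, ∑ b, ∑ c, ∑ d, (M a b * G b c * M' c d) • (C a * (C d)ᵀ) := by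
    simp only [blockMap_apply, Matrix.sum_mul, Matrix.smul_mul]
    refine Finset.sum_congr rfl fun a _ => Finset.sum_congr rfl fun b _ => ?_
    simp only [Matrix.mul_sum, Matrix.mul_smul, key, Finset.smul_sum, smul_smul]
    refine Finset.sum_congr rfl fun c _ => Finset.sum_congr rfl fun d _ => ?_
    congr 1; ring
  rw [lhs, blockMap_apply]
  refine Finset.sum_congr rfl fun a _ => ?_
  rw [Finset.sum_congr rfl fun b _ => Finset.sum_comm, Finset.sum_comm]
  refine Finset.sum_congr rfl fun d _ => ?_
  rw [Finset.sum_comm, Matrix.mul_apply, Finset.sum_smul]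
  refine Finset.sum_congr rfl fun c _ => ?_
  rw [Matrix.mul_apply, Finset.sum_mul, Finset.sum_smul]

theorem transpose_mul_blockMap_mul {C : ι → Matrix X S ℂ} {G : Matrix ι ι ℂ} {P : Matrix S S ℂ}
    (hC : ∀ a b, (C a)ᵀ * C b = G a b • P) (hPP : P * P = P) (M : Matrix ι ι ℂ) (a b : ι) :
    (C a)ᵀ * blockMap C M * C b = (G * M * G) a b • P := by
  have key : ∀ c d, (C a)ᵀ * (C c * (C d)ᵀ) * C b = (G a c * G d b) • P := by
    intro c d
    rw [← Matrix.mul_assoc, hC, Matrix.mul_assoc, hC, Matrix.smul_mul, Matrix.mul_smul, hPP,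
      smul_smul]
  simp only [blockMap_apply, Matrix.sum_mul, Matrix.mul_sum, Matrix.smul_mul, Matrix.mul_smul,
    key, smul_smul, Matrix.mul_apply, Finset.sum_mul, Finset.sum_smul]
  rw [Finset.sum_comm]
  refine Finset.sum_congr rfl fun c _ => Finset.sum_congr rfl fun d _ => ?_
  congr 1; ring

variable [DecidableEq ι]

/-- The homomorphism from a full matrix algebra attached to a family of matrices whose Gram matrix
is `G ⊗ P`. -/
noncomputable def blockHom {C : ι → Matrix X S ℂ} {G : Matrix ι ι ℂ} {P : Matrix S S ℂ}
    (hC : ∀ a b, (C a)ᵀ * C b = G a b • P) (hP : ∀ a, C a * P = C a) (hG : IsUnit G.det) :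
    Matrix ι ι ℂ →ₙₐ[ℂ] Matrix X X ℂ where
  -- Products of block maps carry an extra factor `G`; the twist by `G⁻¹` cancels it.
  toFun M := blockMap C (M * G⁻¹)
  map_smul' r M := by simp
  map_zero' := by simp
  map_add' M M' := by simp [Matrix.add_mul]
  map_mul' M M' := by
    rw [blockMap_mul_blockMap hC hP]
    congr 1
    rw [Matrix.mul_assoc M G⁻¹ G, Matrix.nonsing_inv_mul _ hG, Matrix.mul_one, Matrix.mul_assoc M]

variable {C : ι → Matrix X S ℂ} {G : Matrix ι ι ℂ} {P : Matrix S S ℂ}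

theorem blockHom_apply (hC : ∀ a b, (C a)ᵀ * C b = G a b • P) (hP : ∀ a, C a * P = C a)
    (hG : IsUnit G.det) (M : Matrix ι ι ℂ) : blockHom hC hP hG M = blockMap C (M * G⁻¹) := rfl

theorem blockHom_eq_zero (hC : ∀ a b, (C a)ᵀ * C b = G a b • P) (hP : ∀ a, C a * P = C a)
    (hG : IsUnit G.det) (hPP : P * P = P) (hP0 : P ≠ 0) {M : Matrix ι ι ℂ}
    (hM : blockHom hC hP hG M = 0) : M = 0 := by
  have h : G * M = 0 := by
    ext a b
    have := transpose_mul_blockMap_mul hC hPP (M * G⁻¹) a b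
    rw [← blockHom_apply hC hP hG, hM, Matrix.mul_zero, Matrix.zero_mul, Matrix.mul_assoc G,
      Matrix.mul_assoc M, Matrix.nonsing_inv_mul _ hG, Matrix.mul_one] at this
    exact (smul_eq_zero.mp this.symm).resolve_right hP0
  have := congrArg (fun A => G⁻¹ * A) h
  simpa [← Matrix.mul_assoc, Matrix.nonsing_inv_mul _ hG] using this

/-- Cyclicity of the trace replaces the products of columns by Gram entries, and `G⁻¹ * G = 1`
counts the columns. This is the rank count showing that the blocks do not exhaust the full matrix
algebra. -/
theorem trace_blockHom_one (hC : ∀ a b, (C a)ᵀ * C b = G a b • P) (hP : ∀ a, C a * P = C a)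
    (hG : IsUnit G.det) :
    (blockHom hC hP hG 1).trace = Fintype.card ι * P.trace := by
  have h : ∀ a b, (C a * (C b)ᵀ).trace = G b a * P.trace := fun a b => by
    rw [Matrix.trace_mul_comm, hC, Matrix.trace_smul, smul_eq_mul]
  have h1 : ∑ a, ∑ b, G⁻¹ a b * G b a = Fintype.card ι := by
    have := congrArg Matrix.trace (Matrix.nonsing_inv_mul G hG)
    rw [Matrix.trace_one] at this
    rw [← this]
    simp [Matrix.trace, Matrix.mul_apply]
  rw [blockHom_apply, blockMap_apply, Matrix.one_mul, Matrix.trace_sum, ← h1, Finset.sum_mul]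
  refine Finset.sum_congr rfl fun a _ => ?_
  rw [Matrix.trace_sum, Finset.sum_mul]
  refine Finset.sum_congr rfl fun b _ => ?_
  rw [Matrix.trace_smul, h, smul_eq_mul, mul_assoc]

theorem mul_transpose_eq_blockHom (hC : ∀ a b, (C a)ᵀ * C b = G a b • P)
    (hP : ∀ a, C a * P = C a) (hG : IsUnit G.det) (a b : ι) :
    ∃ M, blockHom hC hP hG M = C a * (C b)ᵀ :=
  ⟨Matrix.single a b 1 * G, by
    rw [blockHom_apply, Matrix.mul_assoc, Matrix.mul_nonsing_inv _ hG, Matrix.mul_one,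
      blockMap_single]⟩

theorem blockMap_mul_blockMap_eq_zero {S' ι' : Type*} [Fintype S'] [Fintype ι']
    {C : ι → Matrix X S ℂ} {C' : ι' → Matrix X S' ℂ} (h : ∀ a b, (C a)ᵀ * C' b = 0)
    (M : Matrix ι ι ℂ) (M' : Matrix ι' ι' ℂ) : blockMap C M * blockMap C' M' = 0 := by
  have key : ∀ a b c d, (C a * (C b)ᵀ) * (C' c * (C' d)ᵀ) = 0 := by
    intro a b c d
    rw [Matrix.mul_assoc, ← Matrix.mul_assoc (C b)ᵀ, h, Matrix.zero_mul, Matrix.mul_zero]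
  simp [blockMap_apply, Matrix.sum_mul, Matrix.mul_sum, key]

end Blocks

/-! ### Orthogonal sums of blocks and the complementary idempotent -/

section Corner

variable {A B B' : Type*} [Ring A] [Algebra ℂ A] [Ring B] [Algebra ℂ B] [Ring B'] [Algebra ℂ B']

/-- The sum of two homomorphisms with orthogonal ranges. -/
def orthogonalSum (f : B →ₙₐ[ℂ] A) (g : B' →ₙₐ[ℂ] A) (hfg : ∀ b c, f b * g c = 0)
    (hgf : ∀ b c, g c * f b = 0) : B × B' →ₙₐ[ℂ] A where
  toFun x := f x.1 + g x.2
  map_smul' r x := by simp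
  map_zero' := by simp
  map_add' x y := by simp only [Prod.fst_add, Prod.snd_add, map_add]; abel
  map_mul' x y := by simp [mul_add, add_mul, hfg, hgf]

theorem orthogonalSum_apply (f : B →ₙₐ[ℂ] A) (g : B' →ₙₐ[ℂ] A) (hfg : ∀ b c, f b * g c = 0)
    (hgf : ∀ b c, g c * f b = 0) (x : B × B') :
    orthogonalSum f g hfg hgf x = f x.1 + g x.2 := rfl

theorem orthogonalSum_eq_zero {f : B →ₙₐ[ℂ] A} {g : B' →ₙₐ[ℂ] A} (hfg : ∀ b c, f b * g c = 0)
    (hgf : ∀ b c, g c * f b = 0) (hf : ∀ b, f b = 0 → b = 0) (hg : ∀ c, g c = 0 → c = 0)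
    (x : B × B') (hx : orthogonalSum f g hfg hgf x = 0) : x = 0 := by
  rw [orthogonalSum_apply] at hx
  have h1 : f x.1 = 0 := by
    have := congrArg (· * f 1) hx
    simpa [add_mul, hgf, ← map_mul] using this
  have h2 : g x.2 = 0 := by simpa [h1] using hx
  exact Prod.ext (hf _ h1) (hg _ h2)

/-- The unital extension of a homomorphism by the complementary idempotent. -/
noncomputable def cornerHom (f : B →ₙₐ[ℂ] A) :
    B × Matrix (Fin 1) (Fin 1) ℂ →ₐ[ℂ] A :=
  AlgHom.ofLinearMap
    { toFun := fun x => f x.1 + x.2 0 0 • (1 - f 1)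
      map_add' := fun x y => by
        simp only [Prod.fst_add, Prod.snd_add, map_add, Matrix.add_apply, add_smul]; abel
      map_smul' := fun r x => by simp [mul_smul] }
    (by simp)
    (fun x y => by
      have h : ∀ b, f b * f 1 = f b := fun b => by rw [← map_mul, mul_one]
      have h' : ∀ b, f 1 * f b = f b := fun b => by rw [← map_mul, one_mul]
      simp [mul_add, add_mul, mul_sub, sub_mul, h, h', Matrix.mul_apply, smul_smul, mul_comm])

theorem cornerHom_apply (f : B →ₙₐ[ℂ] A) (x : B × Matrix (Fin 1) (Fin 1) ℂ) :
    cornerHom f x = f x.1 + x.2 0 0 • (1 - f 1) := rfl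

theorem cornerHom_injective {f : B →ₙₐ[ℂ] A} (hf : ∀ b, f b = 0 → b = 0) (h1 : f 1 ≠ 1) :
    Function.Injective (cornerHom f) := by
  rw [injective_iff_map_eq_zero]
  intro x hx
  rw [cornerHom_apply] at hx
  have h2 : f x.1 = 0 := by
    have := congrArg (· * f 1) hx
    simpa [add_mul, sub_mul, ← map_mul] using this
  rw [h2, zero_add] at hx
  refine Prod.ext (hf _ h2) ?_
  ext i j
  fin_cases i; fin_cases j
  exact (smul_eq_zero.mp hx).resolve_right (sub_ne_zero.mpr h1.symm)

end Corner

/-- Symmetric coordinates on the points of a Latin square with a base point: any two of the three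
coordinates determine the point, and on the three lines through the base point the two remaining
coordinates are interchanged by an involution. -/
structure LatinCoordinates (X S : Type*) where
  coord : Fin 3 → X → S
  base : X
  e : S
  inv : S → S
  inv_inv : ∀ s, inv (inv s) = s
  coord_base : ∀ i, coord i base = e
  bijective : ∀ i j, i ≠ j → Function.Bijective fun x => (coord i x, coord j x)
  coord_eq : ∀ i j k, i ≠ j → i ≠ k → j ≠ k → ∀ x, coord i x = e → coord j x = inv (coord k x)

/-! ### Cells, eigenfunctions of the involution and their sums over cells -/

namespace LatinCoordinates

variable {X S : Type*} [DecidableEq X] [DecidableEq S]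
variable (L : LatinCoordinates X S)

theorem inv_e : L.inv L.e = L.e := by
  have := L.coord_eq 0 1 2 (by decide) (by decide) (by decide) L.base (L.coord_base 0)
  rw [L.coord_base, L.coord_base] at this
  exact this.symm

theorem inv_eq_iff {s t : S} : L.inv s = t ↔ s = L.inv t :=
  ⟨fun h => by rw [← h, L.inv_inv], fun h => by rw [h, L.inv_inv]⟩

theorem inv_eq_e_iff {s : S} : L.inv s = L.e ↔ s = L.e := by rw [L.inv_eq_iff, L.inv_e]

theorem eq_base_of_coord {i j : Fin 3} (hij : i ≠ j) {x : X} (hi : L.coord i x = L.e)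
    (hj : L.coord j x = L.e) : x = L.base :=
  (L.bijective i j hij).1 (by simp [hi, hj, L.coord_base])

/-- The index of the relation in which a point stands to the base point. -/
def cell (x : X) : Fin 5 :=
  if x = L.base then 0 else if L.coord 0 x = L.e then 1 else if L.coord 1 x = L.e then 2 else
    if L.coord 2 x = L.e then 3 else 4

theorem cell_eq_zero {x : X} : L.cell x = 0 ↔ x = L.base := by
  unfold cell
  split_ifs <;> simp_all

theorem cell_eq_line (k : Fin 3) {x : X} :
    L.cell x = k.castSucc.succ ↔ L.coord k x = L.e ∧ x ≠ L.base := by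
  by_cases hx : x = L.base
  · rw [L.cell_eq_zero.mpr hx]
    fin_cases k <;> simp [hx]
  have h01 := L.eq_base_of_coord (i := 0) (j := 1) (x := x) (by decide)
  have h02 := L.eq_base_of_coord (i := 0) (j := 2) (x := x) (by decide)
  have h12 := L.eq_base_of_coord (i := 1) (j := 2) (x := x) (by decide)
  unfold cell
  rw [if_neg hx]
  fin_cases k <;> split_ifs <;> simp_all

theorem cell_eq_four {x : X} : L.cell x = 4 ↔ ∀ i, L.coord i x ≠ L.e := by
  rw [Fin.forall_fin_succ, Fin.forall_fin_succ, Fin.forall_fin_one]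
  have hb := L.coord_base
  unfold cell
  split_ifs with h <;> simp_all

theorem coord_eq_e_iff_of_cell_eq (i : Fin 3) {x y : X} (h : L.cell x = L.cell y) :
    L.coord i x = L.e ↔ L.coord i y = L.e := by
  have key : ∀ z, L.coord i z = L.e ↔ (L.cell z = 0 ∨ L.cell z = i.castSucc.succ) := by
    intro z
    rw [L.cell_eq_zero, L.cell_eq_line]
    have hb := L.coord_base i
    constructor
    · intro hz
      by_cases hzb : z = L.base
      · exact Or.inl hzb
      · exact Or.inr ⟨hz, hzb⟩
    · rintro (rfl | hz)
      · exact hb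
      · exact hz.1
  rw [key, key, h]

theorem forall_cell {p : Fin 5 → Prop} (h0 : p 0) (h : ∀ k : Fin 3, p k.castSucc.succ) (h4 : p 4)
    (m : Fin 5) : p m := by
  have h1 := h 0
  have h2 := h 1
  have h3 := h 2
  fin_cases m <;> assumption

/-- Functions that vanish at the identity, sum to zero and are eigenvectors of the involution. -/
structure IsEigen [Fintype S] (l : ℂ) (f : S → ℂ) : Prop where
  apply_e : f L.e = 0
  sum_eq_zero : ∑ s, f s = 0
  apply_inv : ∀ s, f (L.inv s) = l * f s

/-- The scalars by which sums over a cell act on eigenfunctions. -/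
noncomputable def gramCoeff [Fintype S] (l : ℂ) (m : Fin 5) (i j : Fin 3) : ℂ :=
  if m = 0 then 0 else if m = 4 then (if i = j then (Fintype.card S : ℂ) - 2 else -l) else
    if i.castSucc.succ = m ∨ j.castSucc.succ = m then 0 else if i = j then 1 else l

theorem sum_gramCoeff [Fintype S] (l : ℂ) (i j : Fin 3) :
    gramCoeff (S := S) l 0 i j + gramCoeff (S := S) l 1 i j + gramCoeff (S := S) l 2 i j +
      gramCoeff (S := S) l 3 i j + gramCoeff (S := S) l 4 i j =
        if i = j then (Fintype.card S : ℂ) else 0 := by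
  fin_cases i <;> fin_cases j <;> simp [gramCoeff] <;> ring

variable [Fintype X] [Fintype S]

theorem sum_eq_sum_coord {i j : Fin 3} (hij : i ≠ j) (g : S → S → ℂ) :
    ∑ x, g (L.coord i x) (L.coord j x) = ∑ s, ∑ t, g s t := by
  rw [← Fintype.sum_prod_type' g]
  exact (Equiv.ofBijective _ (L.bijective i j hij)).sum_comp fun q : S × S => g q.1 q.2

variable {L}

/-- For `i ≠ k` exactly one point has coordinate `i` equal to `a` and coordinate `k` equal to `e`;
its coordinate `j` is `a` or `inv a` if `j ≠ k`. If `j = k`, only `f e = 0` occurs; if `i = k`, the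
sum is empty or runs over all values of `f`. -/
theorem IsEigen.sum_line {l : ℂ} {f : S → ℂ} (hf : L.IsEigen l f) (k i j : Fin 3) (a : S) :
    ∑ x, (if L.coord i x = a then 1 else 0) * ((if L.coord k x = L.e then 1 else 0) *
      f (L.coord j x)) = (if i = k ∨ j = k then 0 else if i = j then 1 else l) * f a := by
  by_cases hj : j = k
  · subst hj
    rw [if_pos (Or.inr rfl), zero_mul]
    refine Finset.sum_eq_zero fun x _ => ?_
    split_ifs with h1 h2 <;> simp_all [hf.apply_e]
  by_cases hi : i = k
  · subst hi
    rw [if_pos (Or.inl rfl), zero_mul]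
    rw [L.sum_eq_sum_coord (Ne.symm hj) fun s t =>
      (if s = a then 1 else 0) * ((if s = L.e then 1 else 0) * f t)]
    refine Finset.sum_eq_zero fun s _ => ?_
    rw [← Finset.mul_sum, ← Finset.mul_sum, hf.sum_eq_zero, mul_zero, mul_zero]
  rw [if_neg (by tauto)]
  have : ∀ x, (if L.coord i x = a then 1 else 0) * ((if L.coord k x = L.e then 1 else 0) *
      f (L.coord j x)) = (if L.coord i x = a then 1 else 0) *
        ((if L.coord k x = L.e then 1 else 0) * ((if i = j then 1 else l) * f (L.coord i x))) := by
    intro x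
    by_cases hx : L.coord k x = L.e
    · by_cases hij : i = j
      · subst hij; simp
      · rw [L.coord_eq k j i (Ne.symm hj) (Ne.symm hi) (Ne.symm hij) x hx, hf.apply_inv,
          if_neg hij]
    · simp [hx]
  rw [Finset.sum_congr rfl fun x _ => this x, L.sum_eq_sum_coord hi fun s t =>
      (if s = a then 1 else 0) * ((if t = L.e then 1 else 0) * ((if i = j then 1 else l) * f s))]
  simp

theorem IsEigen.sum_coord {l : ℂ} {f : S → ℂ} (hf : L.IsEigen l f) (i j : Fin 3) (a : S) :
    ∑ x, (if L.coord i x = a then 1 else 0) * f (L.coord j x) =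
      (if i = j then (Fintype.card S : ℂ) else 0) * f a := by
  by_cases hij : i = j
  · subst hij
    have hne : i ≠ i + 1 := by decide +revert
    rw [L.sum_eq_sum_coord hne fun s _ => (if s = a then 1 else 0) * f s]
    simp
  · rw [L.sum_eq_sum_coord hij fun s t => (if s = a then 1 else 0) * f t]
    simp [hf.sum_eq_zero, hij]

theorem IsEigen.sum_cell {l : ℂ} {f : S → ℂ} (hf : L.IsEigen l f) (m : Fin 5) (i j : Fin 3)
    (a : S) :
    ∑ x, (if L.coord i x = a then 1 else 0) * ((if L.cell x = m then 1 else 0) *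
      f (L.coord j x)) = gramCoeff (S := S) l m i j * f a := by
  have h0 : ∑ x, (if L.coord i x = a then 1 else 0) * ((if L.cell x = 0 then 1 else 0) *
      f (L.coord j x)) = gramCoeff (S := S) l 0 i j * f a := by
    rw [gramCoeff, if_pos rfl, zero_mul]
    refine Finset.sum_eq_zero fun x _ => ?_
    by_cases hx : x = L.base
    · rw [hx, L.coord_base j, hf.apply_e, mul_zero, mul_zero]
    · simp [L.cell_eq_zero, hx]
  have hk : ∀ k : Fin 3, ∑ x, (if L.coord i x = a then 1 else 0) *
      ((if L.cell x = k.castSucc.succ then 1 else 0) * f (L.coord j x)) =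
        gramCoeff (S := S) l k.castSucc.succ i j * f a := by
    intro k
    have hc : gramCoeff (S := S) l k.castSucc.succ i j =
        (if i = k ∨ j = k then 0 else if i = j then 1 else l) := by
      have h1 : k.castSucc.succ ≠ 0 := by decide +revert
      have h2 : k.castSucc.succ ≠ 4 := by decide +revert
      simp [gramCoeff, h1, h2]
    rw [hc, ← hf.sum_line k i j a]
    refine Finset.sum_congr rfl fun x _ => ?_
    congr 1
    by_cases hx : x = L.base
    · rw [hx, L.coord_base j, hf.apply_e, mul_zero, mul_zero]
    · simp [L.cell_eq_line, hx]
  refine forall_cell (p := fun m => ∑ x, (if L.coord i x = a then 1 else 0) *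
    ((if L.cell x = m then 1 else 0) * f (L.coord j x)) = gramCoeff (S := S) l m i j * f a)
    h0 hk ?_ m
  -- The generic cell is what remains of the sum over all points after the base point and the three
  -- lines are removed.
  have htot := hf.sum_coord i j a
  have hsplit : ∀ x, (if L.coord i x = a then 1 else 0) * f (L.coord j x) =
      ∑ m, (if L.coord i x = a then 1 else 0) * ((if L.cell x = m then 1 else 0) *
        f (L.coord j x)) := by
    intro x
    rw [← Finset.mul_sum, ← Finset.sum_mul]
    simp
  rw [Finset.sum_congr rfl fun x _ => hsplit x, Finset.sum_comm, Fin.sum_univ_five, h0] at htot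
  have h1 := hk 0
  have h2 := hk 1
  have h3 := hk 2
  simp only [Fin.castSucc_zero, Fin.succ_zero_eq_one, Fin.castSucc_one, Fin.succ_one_eq_two,
    Fin.reduceSucc, Fin.reduceCastSucc] at h1 h2 h3
  rw [h1, h2, h3] at htot
  linear_combination htot - f a * sum_gramCoeff (S := S) l i j

variable (L)

/-- The projection to the eigenfunctions of the involution. -/
noncomputable def proj (l : ℂ) : Matrix S S ℂ :=
  -- The subtracted constant removes the indicator of the complement of `e`. That function is even,
  -- so the correction is `1 / (n - 1)` for `l = 1` and vanishes for `l = -1`.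
  Matrix.of fun s t => if s = L.e ∨ t = L.e then 0 else
    ((if s = t then 1 else 0) + l * (if s = L.inv t then 1 else 0)) / 2 -
      (1 + l) / (2 * ((Fintype.card S : ℂ) - 1))

theorem proj_apply (l : ℂ) (s t : S) : L.proj l s t = if s = L.e ∨ t = L.e then 0 else
    ((if s = t then 1 else 0) + l * (if s = L.inv t then 1 else 0)) / 2 -
      (1 + l) / (2 * ((Fintype.card S : ℂ) - 1)) := rfl

theorem proj_transpose (l : ℂ) : (L.proj l)ᵀ = L.proj l := by
  ext s t
  have h : t = L.inv s ↔ s = L.inv t := by rw [← L.inv_eq_iff, eq_comm]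
  simp only [Matrix.transpose_apply, proj_apply, or_comm, eq_comm (a := t) (b := s), h]

variable {L}

theorem isEigen_proj {l : ℂ} (hl : l * l = 1) (hn : (Fintype.card S : ℂ) - 1 ≠ 0) (t : S) :
    L.IsEigen l fun s => L.proj l s t where
  apply_e := by simp [proj_apply]
  sum_eq_zero := by
    by_cases ht : t = L.e
    · simp [proj_apply, ht]
    -- The last summand corrects the uniform formula at `s = e`.
    · have : ∀ s, L.proj l s t = (((if s = t then 1 else 0) +
          l * (if s = L.inv t then 1 else 0)) / 2 - (1 + l) / (2 * ((Fintype.card S : ℂ) - 1))) +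
          (if s = L.e then (1 + l) / (2 * ((Fintype.card S : ℂ) - 1)) else 0) := by
        intro s
        by_cases hs : s = L.e
        · subst hs
          have h1 : L.e ≠ L.inv t := fun h => ht (L.inv_eq_e_iff.mp h.symm)
          simp [proj_apply, Ne.symm ht, h1]
        · simp [proj_apply, hs, ht]
      simp only [this, Finset.sum_add_distrib, Finset.sum_sub_distrib, ← Finset.sum_div,
        ← Finset.mul_sum, Finset.sum_const, Finset.card_univ, nsmul_eq_mul]
      simp
      field_simp
      ring
  apply_inv s := by
    by_cases hs : s = L.e
    · simp [proj_apply, hs, L.inv_e]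
    by_cases ht : t = L.e
    · simp [proj_apply, ht]
    have hs' : L.inv s ≠ L.e := fun h => hs (L.inv_eq_e_iff.mp h)
    have h1 : L.inv s = L.inv t ↔ s = t := by rw [L.inv_eq_iff, L.inv_inv]
    simp only [proj_apply, hs, ht, hs', or_self, if_false, h1, L.inv_eq_iff (s := s) (t := t)]
    have h2 : l * ((1 + l) / (2 * ((Fintype.card S : ℂ) - 1))) =
        (1 + l) / (2 * ((Fintype.card S : ℂ) - 1)) := by
      rw [← mul_div_assoc, mul_add, hl, mul_one, add_comm]
    rw [mul_sub l, h2]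
    congr 1
    linear_combination (-(if s = L.inv t then (1 : ℂ) else 0) / 2) * hl

theorem IsEigen.proj_mul {m : ℂ} {f : S → ℂ} (hf : L.IsEigen m f) (l : ℂ) (s : S) :
    ∑ t, L.proj l s t * f t = (1 + l * m) / 2 * f s := by
  by_cases hs : s = L.e
  · simp [proj_apply, hs, hf.apply_e]
  have : ∀ t, L.proj l s t * f t = (if s = t then f t / 2 else 0) +
      (if L.inv s = t then l * f t / 2 else 0) -
        (1 + l) / (2 * ((Fintype.card S : ℂ) - 1)) * f t := by
    intro t
    by_cases ht : t = L.e
    · simp [ht, hf.apply_e]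
    · simp only [proj_apply, hs, ht, or_self, if_false, L.inv_eq_iff]
      split_ifs <;> ring
  simp only [this, Finset.sum_sub_distrib, Finset.sum_add_distrib, ← Finset.mul_sum,
    hf.sum_eq_zero, Finset.sum_ite_eq, Finset.mem_univ, if_true, hf.apply_inv]
  ring

theorem proj_mul_proj {l m : ℂ} (hm : m * m = 1) (hn : (Fintype.card S : ℂ) - 1 ≠ 0) :
    L.proj l * L.proj m = ((1 + l * m) / 2) • L.proj m := by
  ext s t
  rw [Matrix.mul_apply, (isEigen_proj hm hn t).proj_mul]
  rfl

variable (L)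

/-- The characteristic column of the identity. -/
def unitCol : Matrix S Unit ℂ := Matrix.of fun s _ => if s = L.e then 1 else 0

/-- The characteristic column of the complement of the identity. -/
def nonunitCol : Matrix S Unit ℂ := Matrix.of fun s _ => if s = L.e then 0 else 1

/-- This resolution of the identity, inserted into a coordinate relation, is what splits the
generators into blocks. -/
theorem one_eq_sum_proj (hn : (Fintype.card S : ℂ) - 1 ≠ 0) :
    (1 : Matrix S S ℂ) = L.unitCol * L.unitColᵀ +
      ((Fintype.card S : ℂ) - 1)⁻¹ • (L.nonunitCol * L.nonunitColᵀ) + L.proj 1 + L.proj (-1) := by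
  ext s t
  simp only [Matrix.add_apply, Matrix.smul_apply, Matrix.mul_apply, Matrix.transpose_apply,
    unitCol, nonunitCol, Matrix.of_apply, proj_apply, Matrix.one_apply, smul_eq_mul,
    Finset.univ_unique, Finset.sum_singleton]
  by_cases hs : s = L.e
  · by_cases ht : t = L.e
    · simp [hs, ht]
    · simp [hs, ht, Ne.symm ht]
  · by_cases ht : t = L.e
    · simp [hs, ht]
    · simp only [hs, ht, or_self, if_false]
      field_simp
      ring

theorem trace_proj_add (hn : (Fintype.card S : ℂ) - 1 ≠ 0) :
    (L.proj 1).trace + (L.proj (-1)).trace = (Fintype.card S : ℂ) - 2 := by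
  have h := congrArg Matrix.trace (L.one_eq_sum_proj hn)
  have h1 : (L.unitCol * L.unitColᵀ).trace = 1 := by
    simp [Matrix.trace, Matrix.mul_apply, unitCol]
  have h2 : (L.nonunitCol * L.nonunitColᵀ).trace = (Fintype.card S : ℂ) - 1 := by
    have : ∀ s, (if s = L.e then (0 : ℂ) else 1) = 1 - if s = L.e then 1 else 0 := by
      intro s; split_ifs <;> simp
    have h' : ∀ s, (if s = L.e then (0 : ℂ) else 1) * (if s = L.e then 0 else 1) =
        if s = L.e then 0 else 1 := by
      intro s; split_ifs <;> simp
    simp only [Matrix.trace, Matrix.mul_apply, nonunitCol, Matrix.transpose_apply,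
      Matrix.diag_apply, Matrix.of_apply, Finset.univ_unique, Finset.sum_singleton, h']
    simp [this]
  rw [Matrix.trace_one, Matrix.trace_add, Matrix.trace_add, Matrix.trace_add, Matrix.trace_smul,
    h1, h2, smul_eq_mul, inv_mul_cancel₀ hn] at h
  linear_combination -h

theorem proj_one_ne_zero (hn : 5 ≤ Fintype.card S) : L.proj 1 ≠ 0 := by
  intro h
  obtain ⟨s, hs⟩ := Finset.exists_mem_notMem_of_card_lt_card (s := {L.e})
    (t := (Finset.univ : Finset S)) (by rw [Finset.card_univ, Finset.card_singleton]; omega)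
  obtain ⟨t, ht⟩ := Finset.exists_mem_notMem_of_card_lt_card (s := {L.e, s, L.inv s})
    (t := (Finset.univ : Finset S)) (by
      rw [Finset.card_univ]; exact lt_of_le_of_lt Finset.card_le_three (by omega))
  simp only [Finset.mem_univ, Finset.mem_singleton, true_and, Finset.mem_insert, not_or] at hs ht
  -- Both indicator terms vanish at this entry, which leaves `-1 / (n - 1)`.
  have := congrFun (congrFun h t) s
  have hn' : (Fintype.card S : ℂ) - 1 ≠ 0 := by
    rw [sub_ne_zero]; norm_cast; omega
  simp [proj_apply, hs, ht, hn'] at this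

end LatinCoordinates

/-! ### Columns spanning the blocks and their Gram matrices -/

namespace LatinCoordinates

variable {X S : Type*} [DecidableEq X] [DecidableEq S] [Fintype X] [Fintype S]
variable (L : LatinCoordinates X S)

/-- The incidence matrix of points and values of a coordinate. -/
def incidence (i : Fin 3) : Matrix X S ℂ :=
  Matrix.of fun x s => if L.coord i x = s then 1 else 0

/-- The diagonal matrix of a cell. -/
def cellMat (m : Fin 5) : Matrix X X ℂ :=
  Matrix.diagonal fun x => if L.cell x = m then 1 else 0

/-- The characteristic column of a cell. -/
def cellCol (m : Fin 5) : Matrix X Unit ℂ := Matrix.of fun x _ => if L.cell x = m then 1 else 0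

/-- The matrix of the relation of having the same coordinate. -/
def lineMat (i : Fin 3) : Matrix X X ℂ := L.incidence i * (L.incidence i)ᵀ

/-- The eigenfunctions of the involution, read off a coordinate on a cell. -/
noncomputable def piece (l : ℂ) (m : Fin 5) (i : Fin 3) : Matrix X S ℂ :=
  L.cellMat m * L.incidence i * L.proj l

theorem incidence_mul_apply {α : Type*} (i : Fin 3) (B : Matrix S α ℂ) (x : X) (t : α) :
    (L.incidence i * B) x t = B (L.coord i x) t := by
  simp [Matrix.mul_apply, incidence]

theorem lineMat_apply (i : Fin 3) (x y : X) :
    L.lineMat i x y = if L.coord i x = L.coord i y then 1 else 0 := by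
  rw [lineMat, incidence_mul_apply]
  simp [incidence, eq_comm]

theorem cellMat_mul_apply {α : Type*} (m : Fin 5) (B : Matrix X α ℂ) (x : X) (t : α) :
    (L.cellMat m * B) x t = if L.cell x = m then B x t else 0 := by
  rw [cellMat, Matrix.diagonal_mul]
  split_ifs <;> simp

theorem piece_apply (l : ℂ) (m : Fin 5) (i : Fin 3) (x : X) (t : S) :
    L.piece l m i x t = if L.cell x = m then L.proj l (L.coord i x) t else 0 := by
  rw [piece, Matrix.mul_assoc, cellMat_mul_apply, incidence_mul_apply]

theorem cellMat_transpose (m : Fin 5) : (L.cellMat m)ᵀ = L.cellMat m := by simp [cellMat]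

theorem cellMat_mul_cellMat (m m' : Fin 5) :
    L.cellMat m * L.cellMat m' = if m = m' then L.cellMat m else 0 := by
  ext x y
  rw [cellMat_mul_apply]
  by_cases hm : m = m'
  · subst hm
    by_cases hxy : x = y
    · subst hxy; simp [cellMat]
    · simp [cellMat, hxy]
  · by_cases hxy : x = y
    · subst hxy; simp [cellMat, hm]; intro h h'; exact hm (h.symm.trans h')
    · simp [cellMat, hxy, hm]

theorem sum_cellMat : ∑ m, L.cellMat m = 1 := by
  ext x y
  rw [Matrix.sum_apply]
  by_cases hxy : x = y
  · subst hxy; simp [cellMat]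
  · simp [cellMat, hxy]

variable {L}

theorem incidence_transpose_mul_cellMat_mul {l : ℂ} (hl : l * l = 1)
    (hn : (Fintype.card S : ℂ) - 1 ≠ 0) (m : Fin 5) (i j : Fin 3) :
    (L.incidence i)ᵀ * (L.cellMat m * (L.incidence j * L.proj l)) =
      gramCoeff (S := S) l m i j • L.proj l := by
  ext s t
  rw [Matrix.mul_apply, Matrix.smul_apply, smul_eq_mul, ← (isEigen_proj hl hn t).sum_cell m i j s]
  refine Finset.sum_congr rfl fun x _ => ?_
  rw [cellMat_mul_apply, incidence_mul_apply]
  simp [incidence]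

theorem piece_mul_proj {l : ℂ} (hl : l * l = 1) (hn : (Fintype.card S : ℂ) - 1 ≠ 0) (m : Fin 5)
    (i : Fin 3) : L.piece l m i * L.proj l = L.piece l m i := by
  rw [piece, Matrix.mul_assoc, proj_mul_proj hl hn, hl]
  norm_num

theorem piece_transpose_mul_piece {l l' : ℂ} (hl : l' * l' = 1)
    (hn : (Fintype.card S : ℂ) - 1 ≠ 0) (m m' : Fin 5) (i j : Fin 3) :
    (L.piece l m i)ᵀ * L.piece l' m' j =
      if m = m' then (gramCoeff (S := S) l' m i j * ((1 + l * l') / 2)) • L.proj l' else 0 := by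
  have h : (L.piece l m i)ᵀ * L.piece l' m' j = L.proj l * ((L.incidence i)ᵀ *
      ((L.cellMat m * L.cellMat m') * (L.incidence j * L.proj l'))) := by
    simp only [piece, Matrix.transpose_mul, proj_transpose, cellMat_transpose, Matrix.mul_assoc]
  rw [h, cellMat_mul_cellMat]
  split_ifs
  · rw [incidence_transpose_mul_cellMat_mul hl hn, Matrix.mul_smul, proj_mul_proj hl hn, smul_smul]
  · simp

theorem line_mul_piece {l : ℂ} (hl : l * l = 1) (hn : (Fintype.card S : ℂ) - 1 ≠ 0)
    (m m' : Fin 5) (i j : Fin 3) :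
    L.cellMat m' * L.lineMat i * L.cellMat m * L.piece l m j =
      gramCoeff (S := S) l m i j • L.piece l m' i := by
  have h : L.cellMat m' * L.lineMat i * L.cellMat m * L.piece l m j =
      L.cellMat m' * (L.incidence i * ((L.incidence i)ᵀ *
        ((L.cellMat m * L.cellMat m) * (L.incidence j * L.proj l)))) := by
    simp only [piece, lineMat, Matrix.mul_assoc]
  rw [h, cellMat_mul_cellMat, if_pos rfl, incidence_transpose_mul_cellMat_mul hl hn,
    Matrix.mul_smul, Matrix.mul_smul, piece, Matrix.mul_assoc]

theorem cellCol_transpose_mul_piece {l : ℂ} (hl : l * l = 1)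
    (hn : (Fintype.card S : ℂ) - 1 ≠ 0) (m m' : Fin 5) (j : Fin 3) :
    (L.cellCol m)ᵀ * L.piece l m' j = 0 := by
  have h1 : (L.cellCol m)ᵀ = (Matrix.of fun _ _ => 1 : Matrix Unit S ℂ) * (L.incidence 0)ᵀ *
      L.cellMat m := by
    -- The indicator of a cell is a constant function read off coordinate 0, so the Gram computation
    -- applies and ends in the sum of an eigenfunction, which is zero.
    have : (L.cellCol m) = L.cellMat m * (L.incidence 0 *
        (Matrix.of fun _ _ => 1 : Matrix S Unit ℂ)) := by
      ext x u
      rw [cellMat_mul_apply, incidence_mul_apply]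
      rfl
    rw [this, Matrix.transpose_mul, Matrix.transpose_mul, cellMat_transpose]
    rfl
  rw [h1]
  have h : (Matrix.of fun _ _ => 1 : Matrix Unit S ℂ) * (L.incidence 0)ᵀ * L.cellMat m *
      L.piece l m' j = (Matrix.of fun _ _ => 1 : Matrix Unit S ℂ) * ((L.incidence 0)ᵀ *
        ((L.cellMat m * L.cellMat m') * (L.incidence j * L.proj l))) := by
    simp only [piece, Matrix.mul_assoc]
  rw [h, cellMat_mul_cellMat]
  split_ifs
  · rw [incidence_transpose_mul_cellMat_mul hl hn, Matrix.mul_smul]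
    have : (Matrix.of fun _ _ => 1 : Matrix Unit S ℂ) * L.proj l = 0 := by
      ext u t
      simpa [Matrix.mul_apply] using (isEigen_proj hl hn t (L := L)).sum_eq_zero
    rw [this, smul_zero]
  · simp

variable (L)

/-- The columns of the isotypic component of an eigenvalue of the involution. -/
noncomputable def blockCol (l : ℂ) : Fin 3 ⊕ Fin 3 → Matrix X S ℂ :=
  Sum.elim (fun k => L.piece l k.castSucc.succ (k + 1)) (fun i => L.piece l 4 i)

/-- The Gram matrix of the columns of an isotypic component. -/
noncomputable def blockGram (S : Type*) [Fintype S] (l : ℂ) :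
    Matrix (Fin 3 ⊕ Fin 3) (Fin 3 ⊕ Fin 3) ℂ :=
  Matrix.fromBlocks 1 0 0 (Matrix.of fun i j => if i = j then (Fintype.card S : ℂ) - 2 else -l)

/-- The Gram matrix of the characteristic columns of the cells. -/
noncomputable def cellGram : Matrix (Fin 5) (Fin 5) ℂ :=
  Matrix.diagonal fun m => ∑ x, if L.cell x = m then 1 else 0

variable {L}

theorem blockCol_transpose_mul {l : ℂ} (hl : l * l = 1) (hn : (Fintype.card S : ℂ) - 1 ≠ 0)
    (a b : Fin 3 ⊕ Fin 3) :
    (L.blockCol l a)ᵀ * L.blockCol l b = blockGram S l a b • L.proj l := by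
  have h : gramCoeff (S := S) l 4 = fun i j => if i = j then (Fintype.card S : ℂ) - 2 else -l := by
    ext i j; simp [gramCoeff]
  have h2 : ∀ k : Fin 3, gramCoeff (S := S) l k.castSucc.succ (k + 1) (k + 1) = 1 := by
    intro k; fin_cases k <;> simp [gramCoeff]
  have h3 : ∀ k : Fin 3, k.castSucc.succ ≠ 4 := by decide
  rcases a with a | a <;> rcases b with b | b <;>
    simp only [blockCol, Sum.elim_inl, Sum.elim_inr, piece_transpose_mul_piece hl hn, blockGram,
      Matrix.fromBlocks_apply₁₁, Matrix.fromBlocks_apply₁₂, Matrix.fromBlocks_apply₂₁,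
      Matrix.fromBlocks_apply₂₂, hl]
  · by_cases hab : a = b
    · subst hab; simp [h2]
    · simp [hab]
  · simp [h3 a]
  · simp [Ne.symm (h3 b)]
  · simp [h]

theorem blockCol_mul_proj {l : ℂ} (hl : l * l = 1) (hn : (Fintype.card S : ℂ) - 1 ≠ 0)
    (a : Fin 3 ⊕ Fin 3) : L.blockCol l a * L.proj l = L.blockCol l a := by
  rcases a with a | a <;> simp [blockCol, piece_mul_proj hl hn]

theorem blockCol_orthogonal {l l' : ℂ} (hl : l' * l' = 1) (hll : l * l' = -1)
    (hn : (Fintype.card S : ℂ) - 1 ≠ 0) (a b : Fin 3 ⊕ Fin 3) :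
    (L.blockCol l a)ᵀ * L.blockCol l' b = 0 := by
  rcases a with a | a <;> rcases b with b | b <;>
    simp [blockCol, piece_transpose_mul_piece hl hn, hll]

theorem cellCol_transpose_mul_blockCol {l : ℂ} (hl : l * l = 1)
    (hn : (Fintype.card S : ℂ) - 1 ≠ 0) (m : Fin 5) (a : Fin 3 ⊕ Fin 3) :
    (L.cellCol m)ᵀ * L.blockCol l a = 0 := by
  rcases a with a | a <;> simp [blockCol, cellCol_transpose_mul_piece hl hn]

theorem blockCol_transpose_mul_cellCol {l : ℂ} (hl : l * l = 1)
    (hn : (Fintype.card S : ℂ) - 1 ≠ 0) (a : Fin 3 ⊕ Fin 3) (m : Fin 5) :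
    (L.blockCol l a)ᵀ * L.cellCol m = 0 := by
  have := congrArg Matrix.transpose (cellCol_transpose_mul_blockCol (L := L) hl hn m a)
  simpa using this

theorem cellCol_transpose_mul (m m' : Fin 5) :
    (L.cellCol m)ᵀ * L.cellCol m' = L.cellGram m m' • (1 : Matrix Unit Unit ℂ) := by
  ext u v
  simp only [Matrix.mul_apply, Matrix.transpose_apply, cellCol, Matrix.of_apply, cellGram,
    Matrix.smul_apply, Matrix.one_apply, smul_eq_mul, if_true, mul_one]
  by_cases h : m = m'
  · subst h
    rw [Matrix.diagonal_apply_eq]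
    refine Finset.sum_congr rfl fun x _ => ?_
    split_ifs <;> simp
  · rw [Matrix.diagonal_apply_ne _ h]
    refine Finset.sum_eq_zero fun x _ => ?_
    split_ifs with h1 h2
    · exact absurd (h1.symm.trans h2) h
    all_goals simp

theorem isUnit_det_blockGram {l : ℂ} (hl : l = 1 ∨ l = -1) (hn : 5 ≤ Fintype.card S) :
    IsUnit (blockGram S l).det := by
  rw [blockGram, Matrix.det_fromBlocks_zero₂₁, Matrix.det_one, one_mul, Matrix.det_fin_three,
    isUnit_iff_ne_zero]
  obtain ⟨k, hk⟩ := Nat.exists_eq_add_of_le hn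
  have h4 : (k : ℂ) + 1 ≠ 0 := by exact_mod_cast Nat.succ_ne_zero k
  have h5 : (k : ℂ) + 2 ≠ 0 := by exact_mod_cast Nat.succ_ne_zero (k + 1)
  have h6 : (k : ℂ) + 4 ≠ 0 := by exact_mod_cast Nat.succ_ne_zero (k + 3)
  have h7 : (k : ℂ) + 5 ≠ 0 := by exact_mod_cast Nat.succ_ne_zero (k + 4)
  -- With `n = k + 5` the generic 3 × 3 part has determinant `(n - 1)² (n - 4)` for `l = 1` and `(n
  -- - 3)² n` for `l = -1`. The factor `n - 4` is where order at least 5 is needed.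
  have : ((k : ℂ) + 4) ^ 2 * (k + 1) ≠ 0 := mul_ne_zero (pow_ne_zero _ h6) h4
  have h' : ((k : ℂ) + 2) ^ 2 * (k + 5) ≠ 0 := mul_ne_zero (pow_ne_zero _ h5) h7
  rw [hk]
  rcases hl with rfl | rfl
  · convert this using 1
    simp
    ring
  · convert h' using 1
    simp
    ring

theorem exists_cell_eq (hn : 5 ≤ Fintype.card S) (m : Fin 5) : ∃ x, L.cell x = m := by
  obtain ⟨s, hs⟩ := Finset.exists_mem_notMem_of_card_lt_card (s := {L.e})
    (t := (Finset.univ : Finset S)) (by rw [Finset.card_univ, Finset.card_singleton]; omega)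
  obtain ⟨t, ht⟩ := Finset.exists_mem_notMem_of_card_lt_card (s := {L.e, L.inv s})
    (t := (Finset.univ : Finset S)) (by
      rw [Finset.card_univ]; exact lt_of_le_of_lt Finset.card_le_two (by omega))
  simp only [Finset.mem_univ, Finset.mem_singleton, true_and, Finset.mem_insert, not_or] at hs ht
  refine forall_cell (p := fun m => ∃ x, L.cell x = m) ⟨L.base, L.cell_eq_zero.mpr rfl⟩ ?_ ?_ m
  · intro k
    have hk : k ≠ k + 1 := by decide +revert
    obtain ⟨x, hx⟩ := (L.bijective k (k + 1) hk).2 (L.e, s)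
    rw [Prod.mk.injEq] at hx
    refine ⟨x, (L.cell_eq_line k).mpr ⟨hx.1, ?_⟩⟩
    rintro rfl
    exact hs (hx.2.symm.trans (L.coord_base _))
  · obtain ⟨x, hx⟩ := (L.bijective 0 1 (by decide)).2 (s, t)
    rw [Prod.mk.injEq] at hx
    refine ⟨x, L.cell_eq_four.mpr ?_⟩
    rw [Fin.forall_fin_succ, Fin.forall_fin_succ, Fin.forall_fin_one]
    refine ⟨hx.1 ▸ hs, ?_, ?_⟩
    · show L.coord 1 x ≠ L.e
      exact hx.2 ▸ ht.1
    · intro h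
      -- A point with coordinates 0 and 1 equal to `s` and `t` lies on the third line only if `t =
      -- inv s`, which the choice of `t` excludes.
      have := L.coord_eq 2 1 0 (by decide) (by decide) (by decide) x h
      rw [hx.1, hx.2] at this
      exact ht.2 this

theorem isUnit_det_cellGram (hn : 5 ≤ Fintype.card S) : IsUnit L.cellGram.det := by
  rw [cellGram, Matrix.det_diagonal, isUnit_iff_ne_zero, Finset.prod_ne_zero_iff]
  intro m _
  rw [Finset.sum_boole, Nat.cast_ne_zero]
  obtain ⟨x, hx⟩ := exists_cell_eq (L := L) hn m
  exact Finset.card_ne_zero.mpr ⟨x, by simp [hx]⟩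

/-- Eigenfunctions vanish at `e`, so nothing survives on the base cell or for coordinate `k` on line
`k`. The other two coordinates on line `k` are exchanged by the involution, so one column per line
suffices. -/
theorem exists_piece_eq_smul_blockCol (l : ℂ) (hl : l * l = 1)
    (hn : (Fintype.card S : ℂ) - 1 ≠ 0) (m : Fin 5) (i : Fin 3) :
    ∃ (r : ℂ) (a : Fin 3 ⊕ Fin 3), L.piece l m i = r • L.blockCol l a := by
  revert m
  refine forall_cell ⟨0, Sum.inl 0, ?_⟩ (fun k => ?_) ⟨1, Sum.inr i, by simp [blockCol]⟩
  · ext x t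
    rw [piece_apply, zero_smul, Matrix.zero_apply]
    split_ifs with h
    · rw [L.cell_eq_zero.mp h, L.coord_base]
      exact (isEigen_proj hl hn t).apply_e
    · rfl
  · by_cases hik : i = k
    · subst hik
      refine ⟨0, Sum.inl 0, ?_⟩
      ext x t
      rw [piece_apply, zero_smul, Matrix.zero_apply]
      split_ifs with h
      · rw [((L.cell_eq_line i).mp h).1]
        exact (isEigen_proj hl hn t).apply_e
      · rfl
    by_cases hik' : i = k + 1
    · subst hik'
      exact ⟨1, Sum.inl k, by simp [blockCol]⟩
    · refine ⟨l, Sum.inl k, ?_⟩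
      ext x t
      simp only [Matrix.smul_apply, blockCol, Sum.elim_inl, piece_apply]
      split_ifs with h
      · have hk : ∀ k : Fin 3, k ≠ k + 1 := by decide
        rw [L.coord_eq k i (k + 1) (Ne.symm hik) (hk k) hik' x ((L.cell_eq_line k).mp h).1]
        exact (isEigen_proj hl hn t).apply_inv _
      · simp

end LatinCoordinates

/-! ### The generated algebra and its blocks -/

namespace LatinCoordinates

variable {X S : Type*} [DecidableEq X] [DecidableEq S] [Fintype X] [Fintype S]
variable (L : LatinCoordinates X S)

/-- The algebra generated by the cells, the coordinate relations and the all-ones matrix. -/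
def cellAlgebra : Subalgebra ℂ (Matrix X X ℂ) :=
  Algebra.adjoin ℂ (Set.range L.cellMat ∪ Set.range L.lineMat ∪ {Matrix.of fun _ _ => 1})

theorem cellMat_mem (m : Fin 5) : L.cellMat m ∈ L.cellAlgebra :=
  Algebra.subset_adjoin (Or.inl (Or.inl ⟨m, rfl⟩))

theorem lineMat_mem (i : Fin 3) : L.lineMat i ∈ L.cellAlgebra :=
  Algebra.subset_adjoin (Or.inl (Or.inr ⟨i, rfl⟩))

theorem ones_mem : (Matrix.of fun _ _ => 1) ∈ L.cellAlgebra :=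
  Algebra.subset_adjoin (Or.inr rfl)

theorem transpose_mem {A : Matrix X X ℂ} (hA : A ∈ L.cellAlgebra) : Aᵀ ∈ L.cellAlgebra := by
  unfold cellAlgebra at hA
  induction hA using Algebra.adjoin_induction with
  | mem A hA =>
    rcases hA with (⟨m, rfl⟩ | ⟨i, rfl⟩) | rfl
    · rw [cellMat_transpose]; exact L.cellMat_mem m
    · rw [lineMat, Matrix.transpose_mul, Matrix.transpose_transpose]; exact L.lineMat_mem i
    · exact L.ones_mem
  | algebraMap r =>
    rw [Algebra.algebraMap_eq_smul_one, Matrix.transpose_smul, Matrix.transpose_one]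
    exact Subalgebra.smul_mem _ (one_mem _) _
  | add A B _ _ hA hB => rw [Matrix.transpose_add]; exact add_mem hA hB
  | mul A B _ _ hA hB => rw [Matrix.transpose_mul]; exact mul_mem hB hA

theorem cellCol_mul_transpose (m m' : Fin 5) : L.cellCol m * (L.cellCol m')ᵀ =
    L.cellMat m * (Matrix.of fun _ _ => 1) * L.cellMat m' := by
  ext x y
  rw [Matrix.mul_assoc, cellMat_mul_apply]
  simp only [cellMat, Matrix.mul_diagonal, Matrix.of_apply, one_mul]
  simp only [cellCol, Matrix.mul_apply, Matrix.transpose_apply, Matrix.of_apply,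
    Finset.univ_unique, Finset.sum_singleton]
  split_ifs <;> simp

theorem cellCol_mul_transpose_mem (m m' : Fin 5) :
    L.cellCol m * (L.cellCol m')ᵀ ∈ L.cellAlgebra := by
  rw [cellCol_mul_transpose]
  exact mul_mem (mul_mem (L.cellMat_mem m) L.ones_mem) (L.cellMat_mem m')

/-- Coordinate `i` equals `e` either throughout a cell or nowhere on it. -/
theorem exists_cellMat_mul_unitCol (m : Fin 5) (i : Fin 3) :
    ∃ r : ℂ, L.cellMat m * L.incidence i * L.unitCol = r • L.cellCol m := by
  by_cases hm : ∃ y, L.cell y = m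
  · obtain ⟨y, rfl⟩ := hm
    refine ⟨if L.coord i y = L.e then 1 else 0, ?_⟩
    ext x u
    rw [Matrix.mul_assoc, cellMat_mul_apply, incidence_mul_apply]
    simp only [unitCol, cellCol, Matrix.of_apply, Matrix.smul_apply, smul_eq_mul]
    by_cases h1 : L.cell x = L.cell y
    · simp [h1, L.coord_eq_e_iff_of_cell_eq i h1]
    · simp [h1]
  · refine ⟨0, ?_⟩
    push Not at hm
    ext x u
    rw [Matrix.mul_assoc, cellMat_mul_apply]
    simp [hm]

theorem exists_cellMat_mul_nonunitCol (m : Fin 5) (i : Fin 3) :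
    ∃ r : ℂ, L.cellMat m * L.incidence i * L.nonunitCol = r • L.cellCol m := by
  obtain ⟨r, hr⟩ := L.exists_cellMat_mul_unitCol m i
  refine ⟨1 - r, ?_⟩
  rw [sub_smul, one_smul, ← hr]
  ext x u
  rw [Matrix.sub_apply, Matrix.mul_assoc, Matrix.mul_assoc, cellMat_mul_apply, cellMat_mul_apply,
    incidence_mul_apply, incidence_mul_apply]
  simp only [unitCol, nonunitCol, cellCol, Matrix.of_apply]
  split_ifs <;> simp

theorem cellMat_mul_lineMat_mul_cellMat (hn : (Fintype.card S : ℂ) - 1 ≠ 0) (m m' : Fin 5)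
    (i : Fin 3) : ∃ r : ℂ, L.cellMat m * L.lineMat i * L.cellMat m' =
      r • (L.cellCol m * (L.cellCol m')ᵀ) + L.piece 1 m i * (L.piece 1 m' i)ᵀ +
        L.piece (-1) m i * (L.piece (-1) m' i)ᵀ := by
  obtain ⟨r, hr⟩ := L.exists_cellMat_mul_unitCol m i
  obtain ⟨r', hr'⟩ := L.exists_cellMat_mul_unitCol m' i
  obtain ⟨t, ht⟩ := L.exists_cellMat_mul_nonunitCol m i
  obtain ⟨t', ht'⟩ := L.exists_cellMat_mul_nonunitCol m' i
  refine ⟨r * r' + ((Fintype.card S : ℂ) - 1)⁻¹ * (t * t'), ?_⟩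
  have hp : ∀ l : ℂ, l * l = 1 → L.cellMat m * L.incidence i * L.proj l *
      (L.cellMat m' * L.incidence i)ᵀ = L.piece l m i * (L.piece l m' i)ᵀ := by
    intro l hl
    have hT : (L.piece l m' i)ᵀ = L.proj l * (L.cellMat m' * L.incidence i)ᵀ := by
      rw [piece, Matrix.transpose_mul, proj_transpose]
    rw [← piece, hT, ← Matrix.mul_assoc, piece_mul_proj hl hn]
  have h : L.cellMat m * L.lineMat i * L.cellMat m' =
      L.cellMat m * L.incidence i * (1 : Matrix S S ℂ) * (L.cellMat m' * L.incidence i)ᵀ := by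
    rw [Matrix.mul_one, Matrix.transpose_mul, cellMat_transpose, lineMat]
    simp only [Matrix.mul_assoc]
  have hu : L.cellMat m * L.incidence i * (L.unitCol * L.unitColᵀ) *
      (L.cellMat m' * L.incidence i)ᵀ = (r * r') • (L.cellCol m * (L.cellCol m')ᵀ) := by
    have : L.cellMat m * L.incidence i * (L.unitCol * L.unitColᵀ) *
        (L.cellMat m' * L.incidence i)ᵀ = (L.cellMat m * L.incidence i * L.unitCol) *
          (L.cellMat m' * L.incidence i * L.unitCol)ᵀ := by
      rw [Matrix.transpose_mul _ L.unitCol]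
      simp only [Matrix.mul_assoc]
    rw [this, hr, hr', Matrix.transpose_smul, Matrix.smul_mul, Matrix.mul_smul, smul_smul]
  have hv : L.cellMat m * L.incidence i * (L.nonunitCol * L.nonunitColᵀ) *
      (L.cellMat m' * L.incidence i)ᵀ = (t * t') • (L.cellCol m * (L.cellCol m')ᵀ) := by
    have : L.cellMat m * L.incidence i * (L.nonunitCol * L.nonunitColᵀ) *
        (L.cellMat m' * L.incidence i)ᵀ = (L.cellMat m * L.incidence i * L.nonunitCol) *
          (L.cellMat m' * L.incidence i * L.nonunitCol)ᵀ := by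
      rw [Matrix.transpose_mul _ L.nonunitCol]
      simp only [Matrix.mul_assoc]
    rw [this, ht, ht', Matrix.transpose_smul, Matrix.smul_mul, Matrix.mul_smul, smul_smul]
  rw [h, L.one_eq_sum_proj hn, Matrix.mul_add, Matrix.mul_add, Matrix.mul_add, Matrix.add_mul,
    Matrix.add_mul, Matrix.add_mul, hp 1 (by norm_num), hp (-1) (by norm_num), hu, Matrix.mul_smul,
    Matrix.smul_mul, hv, smul_smul, add_smul]

theorem cellMat_zero : L.cellMat 0 = L.cellMat 0 * L.lineMat 0 * L.cellMat 0 := by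
  ext x y
  rw [Matrix.mul_assoc, cellMat_mul_apply]
  simp only [cellMat, Matrix.mul_diagonal, Matrix.diagonal_apply, lineMat_apply, cell_eq_zero]
  split_ifs <;> simp_all

theorem cellMat_line (k : Fin 3) : L.cellMat k.castSucc.succ =
    L.cellMat k.castSucc.succ * L.lineMat (k + 1) * L.cellMat k.castSucc.succ := by
  ext x y
  rw [Matrix.mul_assoc, cellMat_mul_apply]
  -- On line `k` coordinate `k + 1` determines the point, so the relation restricted to the line is
  -- the identity.
  simp only [cellMat, Matrix.mul_diagonal, Matrix.diagonal_apply, lineMat_apply]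
  have hk : k ≠ k + 1 := by decide +revert
  by_cases hxy : x = y
  · subst hxy; split_ifs <;> simp_all
  · by_cases h1 : L.cell x = k.castSucc.succ <;> by_cases h2 : L.cell y = k.castSucc.succ
    · have : L.coord (k + 1) x ≠ L.coord (k + 1) y := fun h => hxy <| (L.bijective _ _ hk).1 <| by
        rw [Prod.mk.injEq]
        exact ⟨by rw [((L.cell_eq_line k).mp h1).1, ((L.cell_eq_line k).mp h2).1], h⟩
      simp [hxy, this]
    all_goals simp [hxy, h1, h2]

theorem cellAlgebra_le (hn : (Fintype.card S : ℂ) - 1 ≠ 0) {U : Subalgebra ℂ (Matrix X X ℂ)}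
    (h0 : ∀ m m', L.cellCol m * (L.cellCol m')ᵀ ∈ U)
    (h1 : ∀ a b, L.blockCol 1 a * (L.blockCol 1 b)ᵀ ∈ U)
    (h2 : ∀ a b, L.blockCol (-1) a * (L.blockCol (-1) b)ᵀ ∈ U) : L.cellAlgebra ≤ U := by
  have key : ∀ m m' i, L.cellMat m * L.lineMat i * L.cellMat m' ∈ U := by
    intro m m' i
    obtain ⟨r, hr⟩ := L.cellMat_mul_lineMat_mul_cellMat hn m m' i
    obtain ⟨t, a, ha⟩ := L.exists_piece_eq_smul_blockCol 1 (by norm_num) hn m i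
    obtain ⟨t', a', ha'⟩ := L.exists_piece_eq_smul_blockCol 1 (by norm_num) hn m' i
    obtain ⟨s, b, hb⟩ := L.exists_piece_eq_smul_blockCol (-1) (by norm_num) hn m i
    obtain ⟨s', b', hb'⟩ := L.exists_piece_eq_smul_blockCol (-1) (by norm_num) hn m' i
    rw [hr, ha, ha', hb, hb']
    simp only [Matrix.transpose_smul, Matrix.smul_mul, Matrix.mul_smul]
    exact add_mem (add_mem (U.smul_mem (h0 _ _) _) (U.smul_mem (U.smul_mem (h1 _ _) _) _))
      (U.smul_mem (U.smul_mem (h2 _ _) _) _)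
  have hline : ∀ i, L.lineMat i ∈ U := by
    intro i
    have : L.lineMat i = ∑ m, ∑ m', L.cellMat m * L.lineMat i * L.cellMat m' := by
      simp only [← Matrix.mul_sum, sum_cellMat, Matrix.mul_one, ← Matrix.sum_mul, Matrix.one_mul]
    rw [this]
    exact sum_mem fun m _ => sum_mem fun m' _ => key m m' i
  have hc : ∀ m, m ≠ 4 → L.cellMat m ∈ U := by
    refine forall_cell (fun _ => ?_) (fun k _ => ?_) (fun h => absurd rfl h)
    · rw [cellMat_zero]; exact key _ _ _
    · rw [cellMat_line]; exact key _ _ _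
  refine Algebra.adjoin_le ?_
  rintro A ((⟨m, rfl⟩ | ⟨i, rfl⟩) | rfl)
  · by_cases hm : m = 4
    · subst hm
      -- The generic cell is not in the span of the blocks; it is reached only through the identity
      -- matrix, the source of the summand M_1.
      have : L.cellMat 4 = 1 - ∑ m ∈ Finset.univ.erase 4, L.cellMat m := by
        rw [← L.sum_cellMat, ← Finset.add_sum_erase _ _ (Finset.mem_univ 4), add_sub_cancel_right]
      rw [this]
      exact sub_mem (one_mem _) (sum_mem fun m hm => hc m (Finset.ne_of_mem_erase hm))
    · exact hc m hm
  · exact hline i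
  · have : (Matrix.of fun _ _ => 1 : Matrix X X ℂ) =
        ∑ m, ∑ m', L.cellCol m * (L.cellCol m')ᵀ := by
      simp only [cellCol_mul_transpose, ← Matrix.mul_sum, sum_cellMat, Matrix.mul_one,
        ← Matrix.sum_mul, Matrix.one_mul]
    rw [this]
    exact sum_mem fun m _ => sum_mem fun m' _ => h0 m m'

variable {L}

/-- Moving from cell to cell along a common coordinate carries the column of the first line to any
other column of the same eigenvalue, up to a nonzero scalar. -/
theorem exists_mem_mul_blockCol {l : ℂ} (hl : l * l = 1) (hn : (Fintype.card S : ℂ) - 1 ≠ 0)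
    (a : Fin 3 ⊕ Fin 3) : ∃ Y ∈ L.cellAlgebra, ∃ r : ℂ, r ≠ 0 ∧
      Y * L.blockCol l (Sum.inl 0) = r • L.blockCol l a := by
  have hl0 : l ≠ 0 := by rintro rfl; simp at hl
  have hmem : ∀ m i m', L.cellMat m * L.lineMat i * L.cellMat m' ∈ L.cellAlgebra := fun m i m' =>
    mul_mem (mul_mem (L.cellMat_mem _) (L.lineMat_mem _)) (L.cellMat_mem _)
  have h00 : L.blockCol l (Sum.inl 0) = L.piece l 1 1 := rfl
  rw [h00]
  rcases a with a | a
  · fin_cases a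
    · exact ⟨1, one_mem _, 1, one_ne_zero, by rw [Matrix.one_mul, one_smul]; rfl⟩
    · refine ⟨_, hmem 2 2 1, l, hl0, ?_⟩
      rw [line_mul_piece hl hn]
      have : gramCoeff (S := S) l 1 2 1 = l := by simp [gramCoeff]
      rw [this]; rfl
    · refine ⟨_, hmem 3 1 1, l, hl0, ?_⟩
      rw [line_mul_piece hl hn]
      have : gramCoeff (S := S) l 1 1 1 = 1 := by simp [gramCoeff]
      rw [this, one_smul]
      ext x t
      rw [Matrix.smul_apply, piece_apply]
      show _ = l • L.piece l 3 0 x t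
      rw [piece_apply]
      split_ifs with h
      · rw [L.coord_eq 2 1 0 (by decide) (by decide) (by decide) x ((L.cell_eq_line 2).mp h).1]
        exact (isEigen_proj hl hn t).apply_inv _
      · simp
  · fin_cases a
    -- Coordinate 0 is constant on the first line, so the generic column for it is reached by a
    -- detour through the second line.
    · refine ⟨_, mul_mem (hmem 4 0 2) (hmem 2 2 1), l * l, mul_ne_zero hl0 hl0, ?_⟩
      have h1 : gramCoeff (S := S) l 1 2 1 = l := by simp [gramCoeff]
      have h2 : gramCoeff (S := S) l 2 0 2 = l := by simp [gramCoeff]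
      rw [Matrix.mul_assoc, line_mul_piece hl hn, h1, Matrix.mul_smul, line_mul_piece hl hn, h2,
        smul_smul]
      rfl
    · refine ⟨_, hmem 4 1 1, 1, one_ne_zero, ?_⟩
      have h1 : gramCoeff (S := S) l 1 1 1 = 1 := by simp [gramCoeff]
      rw [line_mul_piece hl hn, h1]; rfl
    · refine ⟨_, hmem 4 2 1, l, hl0, ?_⟩
      have h1 : gramCoeff (S := S) l 1 2 1 = l := by simp [gramCoeff]
      rw [line_mul_piece hl hn, h1]; rfl

/-- Going once around the three lines through the base point realizes the involution. -/
theorem exists_mem_mul_piece (hn : (Fintype.card S : ℂ) - 1 ≠ 0) :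
    ∃ Y ∈ L.cellAlgebra, ∀ l : ℂ, l * l = 1 → Y * L.piece l 1 1 = l • L.piece l 1 1 := by
  have hmem : ∀ m i m', L.cellMat m * L.lineMat i * L.cellMat m' ∈ L.cellAlgebra := fun m i m' =>
    mul_mem (mul_mem (L.cellMat_mem _) (L.lineMat_mem _)) (L.cellMat_mem _)
  -- The walk visits cells 1, 3, 2, 1 along coordinates 1, 0, 2. The scalars met are 1, `l`, `l`,
  -- with product 1; the walk ends in coordinate 2 of the first line, and returning to coordinate 1
  -- costs the factor `l`.
  refine ⟨_, mul_mem (mul_mem (hmem 1 2 2) (hmem 2 0 3)) (hmem 3 1 1), fun l hl => ?_⟩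
  have h1 : gramCoeff (S := S) l 1 1 1 = 1 := by simp [gramCoeff]
  have h2 : gramCoeff (S := S) l 3 0 1 = l := by simp [gramCoeff]
  have h3 : gramCoeff (S := S) l 2 2 0 = l := by simp [gramCoeff]
  rw [Matrix.mul_assoc, Matrix.mul_assoc, line_mul_piece hl hn, h1, one_smul,
    line_mul_piece hl hn, h2, Matrix.mul_smul, line_mul_piece hl hn, h3, smul_smul, hl, one_smul]
  ext x t
  rw [Matrix.smul_apply, piece_apply, piece_apply]
  split_ifs with h
  · rw [L.coord_eq 0 2 1 (by decide) (by decide) (by decide) x ((L.cell_eq_line 0).mp h).1]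
    exact (isEigen_proj hl hn t).apply_inv _
  · simp

/-- The relation restricted to the first line gives the sum of the two products, and the walk around
the lines turns it into their difference. -/
theorem piece_mul_transpose_mem (hn : (Fintype.card S : ℂ) - 1 ≠ 0) :
    L.piece 1 1 1 * (L.piece 1 1 1)ᵀ ∈ L.cellAlgebra ∧
      L.piece (-1) 1 1 * (L.piece (-1) 1 1)ᵀ ∈ L.cellAlgebra := by
  obtain ⟨r, hr⟩ := L.cellMat_mul_lineMat_mul_cellMat hn 1 1 1
  obtain ⟨Y, hY, hYl⟩ := exists_mem_mul_piece (L := L) hn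
  set A := L.piece 1 1 1 * (L.piece 1 1 1)ᵀ with hA
  set B := L.piece (-1) 1 1 * (L.piece (-1) 1 1)ᵀ with hB
  set Z := L.cellMat 1 * L.lineMat 1 * L.cellMat 1 - r • (L.cellCol 1 * (L.cellCol 1)ᵀ) with hZ
  have hZmem : Z ∈ L.cellAlgebra := sub_mem (mul_mem (mul_mem (L.cellMat_mem _) (L.lineMat_mem _))
    (L.cellMat_mem _)) (Subalgebra.smul_mem _ (L.cellCol_mul_transpose_mem _ _) _)
  have hsum : Z = A + B := by rw [hZ, hr]; abel
  have hdiff : Y * Z = A - B := by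
    rw [hsum, Matrix.mul_add, hA, hB, ← Matrix.mul_assoc, ← Matrix.mul_assoc, hYl 1 (by norm_num),
      hYl (-1) (by norm_num), one_smul, neg_one_smul, Matrix.neg_mul, sub_eq_add_neg]
  have hYZ := mul_mem hY hZmem
  have h1 : A = (1 / 2 : ℂ) • (Z + Y * Z) := by rw [hdiff, hsum]; module
  have h2 : B = (1 / 2 : ℂ) • (Z - Y * Z) := by rw [hdiff, hsum]; module
  exact ⟨h1 ▸ Subalgebra.smul_mem _ (add_mem hZmem hYZ) _,
    h2 ▸ Subalgebra.smul_mem _ (sub_mem hZmem hYZ) _⟩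

theorem blockCol_mul_transpose_mem {l : ℂ} (hl : l = 1 ∨ l = -1)
    (hn : (Fintype.card S : ℂ) - 1 ≠ 0) (a b : Fin 3 ⊕ Fin 3) :
    L.blockCol l a * (L.blockCol l b)ᵀ ∈ L.cellAlgebra := by
  have hll : l * l = 1 := by rcases hl with rfl | rfl <;> norm_num
  have h0 : L.blockCol l (Sum.inl 0) * (L.blockCol l (Sum.inl 0))ᵀ ∈ L.cellAlgebra := by
    rcases hl with rfl | rfl
    · exact (piece_mul_transpose_mem hn).1
    · exact (piece_mul_transpose_mem hn).2
  obtain ⟨Y, hY, r, hr, h⟩ := exists_mem_mul_blockCol (L := L) hll hn a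
  obtain ⟨Y', hY', r', hr', h'⟩ := exists_mem_mul_blockCol (L := L) hll hn b
  -- Both factors are transported from the first column; the right one uses closure of the algebra
  -- under transposition.
  have : L.blockCol l a * (L.blockCol l b)ᵀ = (r * r')⁻¹ •
      (Y * (L.blockCol l (Sum.inl 0) * (L.blockCol l (Sum.inl 0))ᵀ) * Y'ᵀ) := by
    have h3 : Y * (L.blockCol l (Sum.inl 0) * (L.blockCol l (Sum.inl 0))ᵀ) * Y'ᵀ =
        (Y * L.blockCol l (Sum.inl 0)) * (Y' * L.blockCol l (Sum.inl 0))ᵀ := by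
      rw [Matrix.transpose_mul]; simp only [Matrix.mul_assoc]
    rw [h3, h, h', Matrix.transpose_smul, Matrix.smul_mul, Matrix.mul_smul, smul_smul, smul_smul,
      mul_assoc, inv_mul_cancel₀ (mul_ne_zero hr hr'), one_smul]
  rw [this]
  exact Subalgebra.smul_mem _ (mul_mem (mul_mem hY h0) (L.transpose_mem hY')) _

end LatinCoordinates

/-! ### Isomorphism with a sum of full matrix algebras -/

namespace LatinCoordinates

variable {X S : Type*} [DecidableEq X] [DecidableEq S] [Fintype X] [Fintype S]
variable (L : LatinCoordinates X S)

theorem card_points (L : LatinCoordinates X S) : Fintype.card X = Fintype.card S * Fintype.card S := by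
  rw [← Fintype.card_prod]
  exact Fintype.card_of_bijective (L.bijective 0 1 (by decide))

theorem card_sub_one_ne_zero (hn : 5 ≤ Fintype.card S) : (Fintype.card S : ℂ) - 1 ≠ 0 := by
  rw [sub_ne_zero]; norm_cast; omega

/-- The primary block. -/
noncomputable def cellHom (hn : 5 ≤ Fintype.card S) :
    Matrix (Fin 5) (Fin 5) ℂ →ₙₐ[ℂ] Matrix X X ℂ :=
  blockHom (cellCol_transpose_mul (L := L)) (fun _ => Matrix.mul_one _) (isUnit_det_cellGram hn)

/-- The block of an eigenvalue of the involution. -/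
noncomputable def eigenHom (hn : 5 ≤ Fintype.card S) {l : ℂ} (hl : l = 1 ∨ l = -1) :
    Matrix (Fin 6) (Fin 6) ℂ →ₙₐ[ℂ] Matrix X X ℂ :=
  (blockHom (blockCol_transpose_mul (L := L) (l := l) (by rcases hl with rfl | rfl <;> norm_num)
    (card_sub_one_ne_zero hn)) (blockCol_mul_proj (by rcases hl with rfl | rfl <;> norm_num)
      (card_sub_one_ne_zero hn)) (isUnit_det_blockGram hl hn)).comp
    ((Matrix.reindexAlgEquiv ℂ ℂ (finSumFinEquiv (m := 3) (n := 3))).symm :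
      Matrix (Fin 6) (Fin 6) ℂ →ₙₐ[ℂ] Matrix (Fin 3 ⊕ Fin 3) (Fin 3 ⊕ Fin 3) ℂ)

variable {L}

theorem exists_blockMap_eq_cellHom (hn : 5 ≤ Fintype.card S) (M : Matrix (Fin 5) (Fin 5) ℂ) :
    ∃ N, L.cellHom hn M = blockMap L.cellCol N := ⟨_, rfl⟩

theorem exists_blockMap_eq_eigenHom (hn : 5 ≤ Fintype.card S) {l : ℂ} (hl : l = 1 ∨ l = -1)
    (M : Matrix (Fin 6) (Fin 6) ℂ) :
    ∃ N, L.eigenHom hn hl M = blockMap (L.blockCol l) N := ⟨_, rfl⟩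

theorem cellHom_eq_zero (hn : 5 ≤ Fintype.card S) (M : Matrix (Fin 5) (Fin 5) ℂ)
    (hM : L.cellHom hn M = 0) : M = 0 :=
  blockHom_eq_zero _ _ _ (Matrix.mul_one _)
    (fun h => by simpa using congrFun (congrFun h ()) ()) hM

theorem eigenHom_eq_zero (hn : 5 ≤ Fintype.card S) {l : ℂ} (hl : l = 1 ∨ l = -1)
    (h0 : L.proj l ≠ 0) (M : Matrix (Fin 6) (Fin 6) ℂ) (hM : L.eigenHom hn hl M = 0) : M = 0 := by
  have hll : l * l = 1 := by rcases hl with rfl | rfl <;> norm_num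
  have hPP : L.proj l * L.proj l = L.proj l := by
    rw [proj_mul_proj hll (card_sub_one_ne_zero hn), hll]; norm_num
  have h : (Matrix.reindexAlgEquiv ℂ ℂ (finSumFinEquiv (m := 3) (n := 3))).symm M = 0 :=
    blockHom_eq_zero (blockCol_transpose_mul hll (card_sub_one_ne_zero hn))
      (blockCol_mul_proj hll (card_sub_one_ne_zero hn)) (isUnit_det_blockGram hl hn) hPP h0 hM
  exact (map_eq_zero_iff _ (AlgEquiv.injective _)).mp h

theorem trace_cellHom_one (hn : 5 ≤ Fintype.card S) : (L.cellHom hn 1).trace = 5 := by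
  rw [cellHom, trace_blockHom_one]
  simp

theorem trace_eigenHom_one (hn : 5 ≤ Fintype.card S) {l : ℂ} (hl : l = 1 ∨ l = -1) :
    (L.eigenHom hn hl 1).trace = 6 * (L.proj l).trace := by
  have h : ((Matrix.reindexAlgEquiv ℂ ℂ (finSumFinEquiv (m := 3) (n := 3))).symm :
      Matrix (Fin 6) (Fin 6) ℂ →ₙₐ[ℂ] Matrix (Fin 3 ⊕ Fin 3) (Fin 3 ⊕ Fin 3) ℂ) 1 = 1 :=
    map_one (Matrix.reindexAlgEquiv ℂ ℂ (finSumFinEquiv (m := 3) (n := 3))).symm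
  rw [eigenHom, NonUnitalAlgHom.comp_apply, h, trace_blockHom_one]
  norm_num

theorem exists_cellHom_eq (hn : 5 ≤ Fintype.card S) (m m' : Fin 5) :
    ∃ M, L.cellHom hn M = L.cellCol m * (L.cellCol m')ᵀ :=
  mul_transpose_eq_blockHom _ _ _ m m'

theorem exists_eigenHom_eq (hn : 5 ≤ Fintype.card S) {l : ℂ} (hl : l = 1 ∨ l = -1)
    (a b : Fin 3 ⊕ Fin 3) :
    ∃ M, L.eigenHom hn hl M = L.blockCol l a * (L.blockCol l b)ᵀ := by
  have hll : l * l = 1 := by rcases hl with rfl | rfl <;> norm_num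
  obtain ⟨M, hM⟩ := mul_transpose_eq_blockHom (blockCol_transpose_mul (L := L) hll
    (card_sub_one_ne_zero hn)) (blockCol_mul_proj hll (card_sub_one_ne_zero hn))
      (isUnit_det_blockGram hl hn) a b
  refine ⟨Matrix.reindexAlgEquiv ℂ ℂ (finSumFinEquiv (m := 3) (n := 3)) M, ?_⟩
  rw [← hM, eigenHom, NonUnitalAlgHom.comp_apply]
  congr 1
  exact AlgEquiv.symm_apply_apply _ M

theorem cellHom_mem (hn : 5 ≤ Fintype.card S) (M : Matrix (Fin 5) (Fin 5) ℂ) :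
    L.cellHom hn M ∈ L.cellAlgebra := by
  obtain ⟨N, hN⟩ := exists_blockMap_eq_cellHom (L := L) hn M
  rw [hN, blockMap_apply]
  exact sum_mem fun a _ => sum_mem fun b _ =>
    Subalgebra.smul_mem _ (L.cellCol_mul_transpose_mem a b) _

theorem eigenHom_mem (hn : 5 ≤ Fintype.card S) {l : ℂ} (hl : l = 1 ∨ l = -1)
    (M : Matrix (Fin 6) (Fin 6) ℂ) : L.eigenHom hn hl M ∈ L.cellAlgebra := by
  obtain ⟨N, hN⟩ := exists_blockMap_eq_eigenHom (L := L) hn hl M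
  rw [hN, blockMap_apply]
  exact sum_mem fun a _ => sum_mem fun b _ =>
    Subalgebra.smul_mem _ (blockCol_mul_transpose_mem hl (card_sub_one_ne_zero hn) a b) _

theorem cellHom_mul_eigenHom (hn : 5 ≤ Fintype.card S) {l : ℂ} (hl : l = 1 ∨ l = -1)
    (M : Matrix (Fin 5) (Fin 5) ℂ) (N : Matrix (Fin 6) (Fin 6) ℂ) :
    L.cellHom hn M * L.eigenHom hn hl N = 0 :=
  blockMap_mul_blockMap_eq_zero (cellCol_transpose_mul_blockCol
    (by rcases hl with rfl | rfl <;> norm_num) (card_sub_one_ne_zero hn)) _ _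

theorem eigenHom_mul_cellHom (hn : 5 ≤ Fintype.card S) {l : ℂ} (hl : l = 1 ∨ l = -1)
    (M : Matrix (Fin 5) (Fin 5) ℂ) (N : Matrix (Fin 6) (Fin 6) ℂ) :
    L.eigenHom hn hl N * L.cellHom hn M = 0 :=
  blockMap_mul_blockMap_eq_zero (blockCol_transpose_mul_cellCol
    (by rcases hl with rfl | rfl <;> norm_num) (card_sub_one_ne_zero hn)) _ _

theorem eigenHom_mul_eigenHom (hn : 5 ≤ Fintype.card S) {l l' : ℂ} (hl : l = 1 ∨ l = -1)
    (hl' : l' = 1 ∨ l' = -1) (hll : l * l' = -1) (M N : Matrix (Fin 6) (Fin 6) ℂ) :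
    L.eigenHom hn hl M * L.eigenHom hn hl' N = 0 :=
  blockMap_mul_blockMap_eq_zero (blockCol_orthogonal
    (by rcases hl' with rfl | rfl <;> norm_num) hll (card_sub_one_ne_zero hn)) _ _

theorem nonempty_algEquiv_prod_of_range {A B : Type*} [Ring A] [Algebra ℂ A] [Ring B] [Algebra ℂ B]
    {T : Subalgebra ℂ A} (f : B →ₙₐ[ℂ] A) (hf : ∀ b, f b = 0 → b = 0) (h1 : f 1 ≠ 1)
    (hT : (cornerHom f).range = T) :
    Nonempty (T ≃ₐ[ℂ] B × Matrix (Fin 1) (Fin 1) ℂ) := by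
  subst hT
  exact ⟨(AlgEquiv.ofInjective _ (cornerHom_injective hf h1)).symm⟩

theorem nonempty_cellAlgebra_algEquiv_of_proj_eq_zero (hn : 5 ≤ Fintype.card S)
    (h0 : L.proj (-1) = 0) :
    Nonempty (L.cellAlgebra ≃ₐ[ℂ]
      (Matrix (Fin 5) (Fin 5) ℂ × Matrix (Fin 6) (Fin 6) ℂ) × Matrix (Fin 1) (Fin 1) ℂ) := by
  have hn1 := card_sub_one_ne_zero hn
  have hpos : (1 : ℂ) = 1 ∨ (1 : ℂ) = -1 := Or.inl rfl
  refine nonempty_algEquiv_prod_of_range (orthogonalSum (L.cellHom hn) (L.eigenHom hn hpos)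
    (cellHom_mul_eigenHom hn hpos) (eigenHom_mul_cellHom hn hpos))
    (orthogonalSum_eq_zero _ _ (cellHom_eq_zero hn)
      (eigenHom_eq_zero hn hpos (L.proj_one_ne_zero hn))) ?_ (le_antisymm ?_ ?_)
  · intro h
    have ht := congrArg Matrix.trace h
    have hp := L.trace_proj_add hn1
    rw [h0, Matrix.trace_zero, add_zero] at hp
    rw [orthogonalSum_apply, Matrix.trace_add, Prod.fst_one, Prod.snd_one, trace_cellHom_one,
      trace_eigenHom_one, hp, Matrix.trace_one, L.card_points] at ht
    obtain ⟨k, hk⟩ := Nat.exists_eq_add_of_le hn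
    rw [hk] at ht
    -- If the blocks filled everything, then `5 + 6 (n - 2) = n²`; with `n = k + 5` this reads `k² +
    -- 4k + 2 = 0`.
    have : ((k * k + 4 * k + 2 : ℕ) : ℂ) = 0 := by push_cast at ht ⊢; linear_combination -ht
    rw [Nat.cast_eq_zero] at this
    omega
  · rintro _ ⟨x, rfl⟩
    have hmem : ∀ y, orthogonalSum (L.cellHom hn) (L.eigenHom hn hpos)
        (cellHom_mul_eigenHom hn hpos) (eigenHom_mul_cellHom hn hpos) y ∈ L.cellAlgebra := fun y =>
      add_mem (cellHom_mem hn _) (eigenHom_mem hn hpos _)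
    exact add_mem (hmem _) (Subalgebra.smul_mem _ (sub_mem (one_mem _) (hmem _)) _)
  · refine L.cellAlgebra_le hn1 (fun m m' => ?_) (fun a b => ?_) (fun a b => ?_)
    · obtain ⟨M, hM⟩ := exists_cellHom_eq (L := L) hn m m'
      exact ⟨((M, 0), 0), by
        change cornerHom _ _ = _
        simp [cornerHom_apply, orthogonalSum_apply, hM]⟩
    · obtain ⟨M, hM⟩ := exists_eigenHom_eq (L := L) hn hpos a b
      exact ⟨((0, M), 0), by
        change cornerHom _ _ = _
        simp [cornerHom_apply, orthogonalSum_apply, hM]⟩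
    · rw [← blockCol_mul_proj (by norm_num) hn1 a, h0, Matrix.mul_zero, Matrix.zero_mul]
      exact zero_mem _

theorem nonempty_cellAlgebra_algEquiv_of_proj_ne_zero (hn : 5 ≤ Fintype.card S)
    (h0 : L.proj (-1) ≠ 0) :
    Nonempty (L.cellAlgebra ≃ₐ[ℂ] (Matrix (Fin 5) (Fin 5) ℂ × (Matrix (Fin 6) (Fin 6) ℂ ×
      Matrix (Fin 6) (Fin 6) ℂ)) × Matrix (Fin 1) (Fin 1) ℂ) := by
  have hn1 := card_sub_one_ne_zero hn
  have hpos : (1 : ℂ) = 1 ∨ (1 : ℂ) = -1 := Or.inl rfl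
  have hneg : (-1 : ℂ) = 1 ∨ (-1 : ℂ) = -1 := Or.inr rfl
  set g := orthogonalSum (L.eigenHom hn hpos) (L.eigenHom hn hneg)
    (eigenHom_mul_eigenHom hn hpos hneg (by norm_num))
    (fun b c => eigenHom_mul_eigenHom hn hneg hpos (by norm_num) c b) with hg
  have hg0 : ∀ x, g x = 0 → x = 0 := orthogonalSum_eq_zero _ _
    (eigenHom_eq_zero hn hpos (L.proj_one_ne_zero hn)) (eigenHom_eq_zero hn hneg h0)
  have hfg : ∀ b c, L.cellHom hn b * g c = 0 := fun b c => by
    rw [hg, orthogonalSum_apply, mul_add, cellHom_mul_eigenHom, cellHom_mul_eigenHom, add_zero]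
  have hgf : ∀ b c, g c * L.cellHom hn b = 0 := fun b c => by
    rw [hg, orthogonalSum_apply, add_mul, eigenHom_mul_cellHom, eigenHom_mul_cellHom, add_zero]
  refine nonempty_algEquiv_prod_of_range (orthogonalSum (L.cellHom hn) g hfg hgf)
    (orthogonalSum_eq_zero _ _ (cellHom_eq_zero hn) hg0) ?_ (le_antisymm ?_ ?_)
  · intro h
    have ht := congrArg Matrix.trace h
    have hp := L.trace_proj_add hn1
    rw [orthogonalSum_apply, hg, orthogonalSum_apply, Matrix.trace_add, Matrix.trace_add,
      Prod.fst_one, Prod.snd_one, Prod.fst_one, Prod.snd_one, trace_cellHom_one,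
      trace_eigenHom_one, trace_eigenHom_one, ← mul_add, hp, Matrix.trace_one,
      L.card_points] at ht
    obtain ⟨k, hk⟩ := Nat.exists_eq_add_of_le hn
    rw [hk] at ht
    have : ((k * k + 4 * k + 2 : ℕ) : ℂ) = 0 := by push_cast at ht ⊢; linear_combination -ht
    rw [Nat.cast_eq_zero] at this
    omega
  · rintro _ ⟨x, rfl⟩
    have hmem : ∀ y, orthogonalSum (L.cellHom hn) g hfg hgf y ∈ L.cellAlgebra := fun y =>
      add_mem (cellHom_mem hn _) (add_mem (eigenHom_mem hn hpos _) (eigenHom_mem hn hneg _))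
    exact add_mem (hmem _) (Subalgebra.smul_mem _ (sub_mem (one_mem _) (hmem _)) _)
  · refine L.cellAlgebra_le hn1 (fun m m' => ?_) (fun a b => ?_) (fun a b => ?_)
    · obtain ⟨M, hM⟩ := exists_cellHom_eq (L := L) hn m m'
      exact ⟨((M, 0), 0), by
        change cornerHom _ _ = _
        simp [cornerHom_apply, orthogonalSum_apply, hM]⟩
    · obtain ⟨M, hM⟩ := exists_eigenHom_eq (L := L) hn hpos a b
      exact ⟨((0, (M, 0)), 0), by
        change cornerHom _ _ = _
        simp [cornerHom_apply, orthogonalSum_apply, hM, hg]⟩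
    · obtain ⟨M, hM⟩ := exists_eigenHom_eq (L := L) hn hneg a b
      exact ⟨((0, (0, M)), 0), by
        change cornerHom _ _ = _
        simp [cornerHom_apply, orthogonalSum_apply, hM, hg]⟩

/-- Reassociation of triple products of algebras. -/
def prodAssocAlgEquiv (A B C : Type*) [Ring A] [Ring B] [Ring C] [Algebra ℂ A] [Algebra ℂ B]
    [Algebra ℂ C] : ((A × B) × C) ≃ₐ[ℂ] A × B × C where
  toEquiv := Equiv.prodAssoc A B C
  map_mul' _ _ := rfl
  map_add' _ _ := rfl
  commutes' _ := rfl

theorem nonempty_cellAlgebra_algEquiv (hn : 5 ≤ Fintype.card S) :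
    Nonempty (L.cellAlgebra ≃ₐ[ℂ]
      Matrix (Fin 5) (Fin 5) ℂ × Matrix (Fin 6) (Fin 6) ℂ × Matrix (Fin 1) (Fin 1) ℂ) ∨
    Nonempty (L.cellAlgebra ≃ₐ[ℂ]
      Matrix (Fin 5) (Fin 5) ℂ × Matrix (Fin 6) (Fin 6) ℂ × Matrix (Fin 6) (Fin 6) ℂ ×
        Matrix (Fin 1) (Fin 1) ℂ) := by
  by_cases h0 : L.proj (-1) = 0
  · obtain ⟨f⟩ := nonempty_cellAlgebra_algEquiv_of_proj_eq_zero hn h0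
    exact Or.inl ⟨f.trans (prodAssocAlgEquiv _ _ _)⟩
  · obtain ⟨f⟩ := nonempty_cellAlgebra_algEquiv_of_proj_ne_zero hn h0
    exact Or.inr ⟨f.trans ((prodAssocAlgEquiv _ _ _).trans
      (AlgEquiv.prodCongr AlgEquiv.refl (prodAssocAlgEquiv _ _ _)))⟩

end LatinCoordinates

/-- The condition on a Bol loop under which the three lines through the cell `(a, b)` of the
Cayley table determine an involution. -/
theorem IsBolLoop.mul_eq_mul {Q : Type*} [Mul Q] (hQ : IsBolLoop Q) {a b x y x' y' : Q}
    (h1 : x * y = a * b) (h2 : a * y = x' * b) (h3 : x' * y' = a * b) : a * y' = x * b := by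
  have hq := hQ.isQuasigroup
  have left_cancel : ∀ {u v w : Q}, u * v = u * w → v = w := fun {u v w} h =>
    (hq.existsUnique_mul_left u (u * w)).unique h rfl
  have right_cancel : ∀ {u v w : Q}, v * u = w * u → v = w := fun {u v w} h =>
    (hq.existsUnique_mul_right u (w * u)).unique h rfl
  rcases hQ with hQ | hQ
  · obtain ⟨e, he⟩ := hQ.exists_identity
    obtain ⟨z, hz, -⟩ := hq.existsUnique_mul_left y e
    -- The right inverse property, from the Bol identity with `y` and its right inverse `z`.
    have inv_right : ∀ c, (c * y) * z = c := fun c => by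
      apply right_cancel (u := y)
      rw [hQ.right_bol, hz, (he y).2]
    have bol : ∀ c, ((c * b) * z) * b = c * ((b * z) * b) := hQ.right_bol b z
    -- The element `(b * z) * b` solves both equations for `y'`: `a` times it is `x * b`, and `x'`
    -- times it is `a * b`.
    have hax : a * ((b * z) * b) = x * b := by rw [← bol, ← h1, inv_right]
    have hx' : x' * ((b * z) * b) = x' * y' := by rw [← bol, ← h2, inv_right, h3]
    rw [← left_cancel hx', hax]
  · obtain ⟨e, he⟩ := hQ.exists_identity
    obtain ⟨z, hz, -⟩ := hq.existsUnique_mul_right x e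
    have inv_left : ∀ c, z * (x * c) = c := fun c => by
      apply left_cancel (u := x)
      rw [hQ.left_bol, hz, (he x).1]
    have bol : ∀ c, a * (z * (a * c)) = (a * (z * a)) * c := hQ.left_bol a z
    -- In the left case the Bol identity identifies `x'` as `a * (z * a)`.
    have hb : (a * (z * a)) * b = x' * b := by rw [← bol, ← h1, inv_left, h2]
    have hy' : a * (z * (a * y')) = a * b := by rw [bol, right_cancel hb, h3]
    have := left_cancel hy'
    apply left_cancel (u := z)
    rw [this, inv_left]

/-! ### Symmetric coordinates on the Cayley table of a Bol loop -/

namespace LatinSquare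

variable {Q : Type*} [Mul Q]

theorem cayleyTable_point_eq (h : IsQuasigroup Q) (x : (cayleyTable h).Point) :
    x.row * x.col = x.sym := x.2

theorem cayleyTable_point_ext {h : IsQuasigroup Q} {x y : (cayleyTable h).Point}
    (h1 : x.row = y.row) (h2 : x.col = y.col) : x = y := by
  apply Subtype.ext
  refine Prod.ext h1 (Prod.ext h2 ?_)
  have hx := cayleyTable_point_eq h x
  have hy := cayleyTable_point_eq h y
  rw [h1, h2, hy] at hx
  exact hx.symm

/-- The point in a given row and column of a Cayley table. -/
def cayleyTablePoint (h : IsQuasigroup Q) (x y : Q) : (cayleyTable h).Point := ⟨(x, y, x * y), rfl⟩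

/-- The symmetric coordinates of the Cayley table of a Bol loop. -/
theorem exists_latinCoordinates (hQ : IsBolLoop Q) (p : (cayleyTable hQ.isQuasigroup).Point) :
    ∃ L : LatinCoordinates (cayleyTable hQ.isQuasigroup).Point Q, L.base = p ∧
      (∀ x y, L.coord 0 x = L.coord 0 y ↔ x.row = y.row) ∧
      (∀ x y, L.coord 1 x = L.coord 1 y ↔ x.col = y.col) ∧
      (∀ x y, L.coord 2 x = L.coord 2 y ↔ x.sym = y.sym) := by
  have hq := hQ.isQuasigroup
  have lc : ∀ {u v w : Q}, u * v = u * w → v = w := fun {u v w} h =>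
    (hq.existsUnique_mul_left u (u * w)).unique h rfl
  have rc : ∀ {u v w : Q}, v * u = w * u → v = w := fun {u v w} h =>
    (hq.existsUnique_mul_right u (w * u)).unique h rfl
  set a := p.row
  set b := p.col
  choose ld hld using fun u v => (hq.existsUnique_mul_left u v).exists
  choose rd hrd using fun u v => (hq.existsUnique_mul_right u v).exists
  -- Along the points with symbol `a * b`, this sends the row label `x * b` to the column label `a *
  -- y`.
  set inv : Q → Q := fun s => a * ld (rd b s) (a * b) with hinv
  have inv_mul : ∀ x y, x * y = a * b → inv (x * b) = a * y := by
    intro x y hxy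
    have h1 : rd b (x * b) = x := rc (hrd b (x * b))
    have h2 : ld x (a * b) = y := lc ((hld x (a * b)).trans hxy.symm)
    simp only [hinv, h1, h2]
  have inv_inv : ∀ s, inv (inv s) = s := by
    intro s
    obtain ⟨x, rfl⟩ : ∃ x, x * b = s := ⟨_, hrd b s⟩
    obtain ⟨y, hy⟩ : ∃ y, x * y = a * b := ⟨_, hld x (a * b)⟩
    obtain ⟨x', hx'⟩ : ∃ x', x' * b = a * y := ⟨_, hrd b (a * y)⟩
    obtain ⟨y', hy'⟩ : ∃ y', x' * y' = a * b := ⟨_, hld x' (a * b)⟩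
    rw [inv_mul x y hy, ← hx', inv_mul x' y' hy']
    exact hQ.mul_eq_mul hy hx'.symm hy'
  have inv_inj : ∀ {s t}, inv s = inv t → s = t := fun {s t} h => by
    rw [← inv_inv s, h, inv_inv]
  have inv_e : inv (a * b) = a * b := inv_mul a b rfl
  have hp : p.sym = a * b := (cayleyTable_point_eq hq p).symm
  have hsym := cayleyTable_point_eq hq
  -- On the lines in row `a` and column `b` the symbol equals the label of the other coordinate.
  -- Twisting the symbol by `inv` makes these two lines behave like the third.
  let c : Fin 3 → (cayleyTable hq).Point → Q :=
    ![fun x => x.row * b, fun x => a * x.col, fun x => inv x.sym]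
  have c0 : ∀ x, c 0 x = x.row * b := fun _ => rfl
  have c1 : ∀ x, c 1 x = a * x.col := fun _ => rfl
  have c2 : ∀ x, c 2 x = inv x.sym := fun _ => rfl
  have hrow : ∀ {x y}, c 0 x = c 0 y → x.row = y.row := fun h => rc h
  have hcol : ∀ {x y}, c 1 x = c 1 y → x.col = y.col := fun h => lc h
  have hsy : ∀ {x y}, c 2 x = c 2 y → x.sym = y.sym := fun h => inv_inj h
  have bij01 : Function.Bijective fun x => (c 0 x, c 1 x) := by
    refine ⟨fun x y h => ?_, fun ⟨s, t⟩ => ⟨cayleyTablePoint hq (rd b s) (ld a t), ?_⟩⟩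
    · rw [Prod.mk.injEq] at h
      exact cayleyTable_point_ext (hrow h.1) (hcol h.2)
    · exact Prod.ext (hrd b s) (hld a t)
  have bij02 : Function.Bijective fun x => (c 0 x, c 2 x) := by
    refine ⟨fun x y h => ?_, fun ⟨s, t⟩ =>
      ⟨cayleyTablePoint hq (rd b s) (ld (rd b s) (inv t)), ?_⟩⟩
    · rw [Prod.mk.injEq] at h
      have h2 := hsy h.2
      rw [← hsym x, ← hsym y, hrow h.1] at h2
      exact cayleyTable_point_ext (hrow h.1) (lc h2)
    · refine Prod.ext (hrd b s) ?_
      change inv (rd b s * ld (rd b s) (inv t)) = t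
      rw [hld, inv_inv]
  have bij12 : Function.Bijective fun x => (c 1 x, c 2 x) := by
    refine ⟨fun x y h => ?_, fun ⟨s, t⟩ =>
      ⟨cayleyTablePoint hq (rd (ld a s) (inv t)) (ld a s), ?_⟩⟩
    · rw [Prod.mk.injEq] at h
      have h2 := hsy h.2
      rw [← hsym x, ← hsym y, hcol h.1] at h2
      exact cayleyTable_point_ext (rc h2) (hcol h.1)
    · refine Prod.ext (hld a s) ?_
      change inv (rd (ld a s) (inv t) * ld a s) = t
      rw [hrd, inv_inv]
  have swap : ∀ {i j : Fin 3}, (Function.Bijective fun x => (c i x, c j x)) →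
      Function.Bijective fun x => (c j x, c i x) := fun h => Prod.swap_bijective.comp h
  have eq0 : ∀ x, c 0 x = a * b → c 1 x = inv (c 2 x) := by
    intro x hx
    rw [c0] at hx
    rw [c1, c2, inv_inv, ← hsym x, rc hx]
  have eq1 : ∀ x, c 1 x = a * b → c 0 x = inv (c 2 x) := by
    intro x hx
    rw [c1] at hx
    rw [c0, c2, inv_inv, ← hsym x, lc hx]
  have eq2 : ∀ x, c 2 x = a * b → c 1 x = inv (c 0 x) := by
    intro x hx
    rw [c2, ← inv_e] at hx
    rw [c0, c1, inv_mul x.row x.col ((hsym x).trans (inv_inj hx))]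
  have flip : ∀ {s t}, s = inv t → t = inv s := fun h => by rw [h, inv_inv]
  refine ⟨{ coord := c, base := p, e := a * b, inv := inv, inv_inv := inv_inv,
            coord_base := ?_, bijective := ?_, coord_eq := ?_ }, rfl, ?_, ?_, ?_⟩
  · rw [Fin.forall_fin_succ, Fin.forall_fin_succ, Fin.forall_fin_one]
    refine ⟨rfl, rfl, ?_⟩
    change inv p.sym = a * b
    rw [hp, inv_e]
  · intro i j hij
    fin_cases i <;> fin_cases j
    · exact absurd rfl hij
    · exact bij01
    · exact bij02
    · exact swap bij01
    · exact absurd rfl hij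
    · exact bij12
    · exact swap bij02
    · exact swap bij12
    · exact absurd rfl hij
  · intro i j k hij hik hjk x hx
    fin_cases i <;> fin_cases j <;> fin_cases k <;>
      first
        | exact absurd rfl hij
        | exact absurd rfl hik
        | exact absurd rfl hjk
        | exact eq0 x hx
        | exact eq1 x hx
        | exact eq2 x hx
        | exact flip (eq0 x hx)
        | exact flip (eq1 x hx)
        | exact flip (eq2 x hx)
  · exact fun x y => ⟨hrow, fun h => congrArg (· * b) h⟩
  · exact fun x y => ⟨hcol, fun h => congrArg (a * ·) h⟩
  · exact fun x y => ⟨hsy, fun h => congrArg inv h⟩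

end LatinSquare

/-! ### The Terwilliger algebra in symmetric coordinates -/

namespace LatinSquare

variable {I S T : Type*} [Finite I] [Finite S] [Fintype T] [DecidableEq T] {M : LatinSquare I S}

/-- Relabelling preserves equality of rows, columns and symbols, so the two generating sets are
related linearly: a coordinate relation is the identity plus one relation matrix, the all-ones
matrix is the sum of all five, and the dual idempotents are the cells. -/
theorem terwilligerAlgebra_eq_cellAlgebra (L : LatinCoordinates M.Point T)
    (h0 : ∀ x y, L.coord 0 x = L.coord 0 y ↔ x.row = y.row)
    (h1 : ∀ x y, L.coord 1 x = L.coord 1 y ↔ x.col = y.col)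
    (h2 : ∀ x y, L.coord 2 x = L.coord 2 y ↔ x.sym = y.sym) :
    M.terwilligerAlgebra L.base = L.cellAlgebra := by
  classical
  have e01 : ∀ {x y}, L.coord 0 x = L.coord 0 y → L.coord 1 x = L.coord 1 y → x = y :=
    fun h h' => (L.bijective 0 1 (by decide)).1 (Prod.ext h h')
  have e02 : ∀ {x y}, L.coord 0 x = L.coord 0 y → L.coord 2 x = L.coord 2 y → x = y :=
    fun h h' => (L.bijective 0 2 (by decide)).1 (Prod.ext h h')
  have e12 : ∀ {x y}, L.coord 1 x = L.coord 1 y → L.coord 2 x = L.coord 2 y → x = y :=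
    fun h h' => (L.bijective 1 2 (by decide)).1 (Prod.ext h h')
  have hA : ∀ m x y, M.relationMatrix m x y = if M.schemeRel m x y then 1 else 0 :=
    fun _ _ _ => by simp [relationMatrix]
  have hrel : ∀ x y, (M.schemeRel 0 x y ↔ x = y) ∧
      (M.schemeRel 1 x y ↔ L.coord 0 x = L.coord 0 y ∧ x ≠ y) ∧
      (M.schemeRel 2 x y ↔ L.coord 1 x = L.coord 1 y ∧ x ≠ y) ∧
      (M.schemeRel 3 x y ↔ L.coord 2 x = L.coord 2 y ∧ x ≠ y) ∧
      (M.schemeRel 4 x y ↔ ¬ L.coord 0 x = L.coord 0 y ∧ ¬ L.coord 1 x = L.coord 1 y ∧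
        ¬ L.coord 2 x = L.coord 2 y) := by
    intro x y
    simp only [schemeRel, ← h0, ← h1, ← h2, ne_eq]
    by_cases hxy : x = y
    · subst hxy; simp
    · have a := fun h h' => hxy (e01 (x := x) (y := y) h h')
      have b := fun h h' => hxy (e02 (x := x) (y := y) h h')
      have c := fun h h' => hxy (e12 (x := x) (y := y) h h')
      tauto
  have hD : ∀ m, M.dualIdempotent L.base m = L.cellMat m := by
    intro m
    unfold dualIdempotent LatinCoordinates.cellMat
    congr 1
    ext x
    rw [hA]
    have hcell : M.schemeRel m L.base x ↔ L.cell x = m := by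
      revert m
      obtain ⟨r0, r1, r2, r3, r4⟩ := hrel L.base x
      simp only [L.coord_base, eq_comm (a := L.e)] at r1 r2 r3 r4
      have k : ∀ j, (L.coord j x = L.e ∧ L.base ≠ x) ↔ L.cell x = j.castSucc.succ := fun j => by
        rw [L.cell_eq_line, ne_comm]
      refine LatinCoordinates.forall_cell ?_ (fun j => ?_) ?_
      · rw [r0, L.cell_eq_zero, eq_comm]
      · rw [← k]
        fin_cases j
        · exact r1
        · exact r2
        · exact r3
      · rw [r4, L.cell_eq_four, Fin.forall_fin_succ, Fin.forall_fin_succ, Fin.forall_fin_one]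
        rfl
    simp only [hcell]
  have hA0 : M.relationMatrix 0 = 1 := by
    ext x y; simp [hA, (hrel x y).1, Matrix.one_apply]
  have hline : ∀ j : Fin 3, L.lineMat j = 1 + M.relationMatrix j.castSucc.succ := by
    intro j
    ext x y
    have hj : M.schemeRel j.castSucc.succ x y ↔ L.coord j x = L.coord j y ∧ x ≠ y := by
      fin_cases j
      · exact (hrel x y).2.1
      · exact (hrel x y).2.2.1
      · exact (hrel x y).2.2.2.1
    rw [L.lineMat_apply, Matrix.add_apply, hA, Matrix.one_apply]
    simp only [hj]
    by_cases hxy : x = y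
    · subst hxy; simp
    · simp [hxy]
  have hJ : (Matrix.of fun _ _ => 1 : Matrix M.Point M.Point ℂ) = M.relationMatrix 0 +
      M.relationMatrix 1 + M.relationMatrix 2 + M.relationMatrix 3 + M.relationMatrix 4 := by
    ext x y
    obtain ⟨r0, r1, r2, r3, r4⟩ := hrel x y
    simp only [Matrix.add_apply, hA, r0, r1, r2, r3, r4, Matrix.of_apply]
    by_cases hxy : x = y
    · subst hxy; simp
    · have a := fun h h' => hxy (e01 (x := x) (y := y) h h')
      have b := fun h h' => hxy (e02 (x := x) (y := y) h h')
      have c := fun h h' => hxy (e12 (x := x) (y := y) h h')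
      by_cases g0 : L.coord 0 x = L.coord 0 y
      · have g1 : ¬ L.coord 1 x = L.coord 1 y := a g0
        have g2 : ¬ L.coord 2 x = L.coord 2 y := b g0
        simp [g0, g1, g2, hxy]
      by_cases g1 : L.coord 1 x = L.coord 1 y
      · have g2 : ¬ L.coord 2 x = L.coord 2 y := c g1
        simp [g0, g1, g2, hxy]
      by_cases g2 : L.coord 2 x = L.coord 2 y <;> simp [g0, g1, g2, hxy]
  apply le_antisymm
  · refine Algebra.adjoin_le ?_
    have hA' : ∀ m, m ≠ 4 → M.relationMatrix m ∈ L.cellAlgebra := by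
      refine LatinCoordinates.forall_cell (fun _ => ?_) (fun j _ => ?_) (fun h => absurd rfl h)
      · rw [hA0]; exact one_mem _
      · rw [← add_sub_cancel_left 1 (M.relationMatrix _), ← hline]
        exact sub_mem (L.lineMat_mem j) (one_mem _)
    rintro _ (⟨m, rfl⟩ | ⟨m, rfl⟩)
    · by_cases hm : m = 4
      · subst hm
        rw [← sub_eq_iff_eq_add'] at hJ
        rw [SetLike.mem_coe, ← hJ]
        exact sub_mem L.ones_mem (add_mem (add_mem (add_mem (hA' 0 (by decide))
          (hA' 1 (by decide))) (hA' 2 (by decide))) (hA' 3 (by decide)))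
      · exact hA' m hm
    · rw [hD]; exact L.cellMat_mem m
  · have hmem : ∀ m, M.relationMatrix m ∈ M.terwilligerAlgebra L.base := fun m =>
      Algebra.subset_adjoin (Or.inl ⟨m, rfl⟩)
    refine Algebra.adjoin_le ?_
    rintro _ ((⟨m, rfl⟩ | ⟨j, rfl⟩) | rfl)
    · rw [← hD]; exact Algebra.subset_adjoin (Or.inr ⟨m, rfl⟩)
    · rw [hline]; exact add_mem (one_mem _) (hmem _)
    · rw [hJ]
      exact add_mem (add_mem (add_mem (add_mem (hmem _) (hmem _)) (hmem _)) (hmem _)) (hmem _)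

end LatinSquare

theorem theorem6p3 {Q : Type*} [Mul Q] [Finite Q] (hQ : IsBolLoop Q) (hn : 5 ≤ Nat.card Q)
    (p : (cayleyTable hQ.isQuasigroup).Point) :
    Nonempty ((cayleyTable hQ.isQuasigroup).terwilligerAlgebra p ≃ₐ[ℂ]
      Matrix (Fin 5) (Fin 5) ℂ × Matrix (Fin 6) (Fin 6) ℂ × Matrix (Fin 1) (Fin 1) ℂ) ∨
    Nonempty ((cayleyTable hQ.isQuasigroup).terwilligerAlgebra p ≃ₐ[ℂ]
      Matrix (Fin 5) (Fin 5) ℂ × Matrix (Fin 6) (Fin 6) ℂ × Matrix (Fin 6) (Fin 6) ℂ ×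
        Matrix (Fin 1) (Fin 1) ℂ) := by
  classical
  have := Fintype.ofFinite Q
  rw [Nat.card_eq_fintype_card] at hn
  obtain ⟨L, rfl, h0, h1, h2⟩ := LatinSquare.exists_latinCoordinates hQ p
  rw [LatinSquare.terwilligerAlgebra_eq_cellAlgebra L h0 h1 h2]
  exact LatinCoordinates.nonempty_cellAlgebra_algEquiv hn
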